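/- **Setting.** Let $\Omega\subset\mathbb R^{d}$ be open and bounded, let $E(\mu)=\sum_i f_i(\mu)E_i$, $A(\mu)=\sum_i g_i(\mu)A_i$ (real $n\times n$), $B(\mu)=\sum_i h_i(\mu)B_i$ (real $n\times m$), $C(\mu)=\sum_i k_i(\mu)C_i$ (real $p\times n$) with finitely many fixed real matrices and real-analytic functions $f_i,g_i,h_i,k_i$ on $\Omega$. Put $D(\mu,s)=sE(\mu)-A(\mu)$, $H[\mu](s)=C(\mu)D(\mu,s)^{-1}B(\mu)$, and let $\sigma(\mu,\omega)\ge\sigma_2(\mu,\omega)$ be the two largest singular values of $H[\mu](\mathrm i\omega)$ (singular values beyond the last one are $0$). Write $\|H[\mu]\|_{\mathcal H_\infty}=\sup_{\operatorname{Re}s>0}\|H[\mu](s)\|_2$; $H[\mu]\in\mathcal H_\infty$ means that the pencil $D(\mu,\cdot)$ is regular and this supremum is finite. For $V,W\in\mathbb C^{n\times r}$ with orthonormal columns let $D^{V,W}=W^*DV$, $H^{V,W}[\mu](s)=C(\mu)V\,D^{V,W}(\mu,s)^{-1}\,W^*B(\mu)$, and let $\sigma^{V,W},\sigma_2^{V,W}$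 be the two largest singular values of $H^{V,W}[\mu](\mathrm i\omega)$. Subscripts denote partial derivatives; $\sigma_{\min}$ is the smallest singular value; $\overline{\mathcal B}(x,\eta)$ is the closed Euclidean ball. Let $\underline\Omega\subset\Omega$ be compact, $H[\mu]\in\mathcal H_\infty$ for all $\mu\in\underline\Omega$, and let $\mu_*\in\underline\Omega$ be a local (or global) minimizer of $\|H[\cdot]\|_{\mathcal H_\infty}$ on $\underline\Omega$. Assume that $H[\mu]\in\mathcal H_\infty$ for all $\mu$ in a neighbourhood of $\mu_*$ and that $\sigma$, extended to frequencies in $\mathbb R\cup\{\infty\}$ by taking limits in $\omega$ at $\infty$ and at removable singularities of $H[\mu](\mathrm i\,\cdot)$, is continuous at every point of $\{\mu_*\}\times(\mathbb R\cup\{\infty\})$. Assume that the maximum of $\sigma(\mu_*,\cdot)$ over $\mathbb R\cup\{\infty\}$ is attained at some $\omega_*\in\mathbb R$, uniquely up to the sign of $\omega_*$ (the data are real, so $\sigma(\mu,\cdot)$ is even), and that $\sigma(\mu_*,\omega_*)>0$ is a simple singular value, i.e. $\sigma_2(\mu_*,\omega_*)<\sigma(\mu_*,\omega_*)$. **Algorithms.**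 A run of the *basic* algorithm starts from matrices $V_0,W_0$ with orthonormal columns, equally many in both. Step $j\ge1$: choose a minimizer $\mu^{(j)}$ over $\mu\in\underline\Omega$ of $\sup_{\omega\in\mathbb R}\sigma^{V_{j-1},W_{j-1}}(\mu,\omega)$ (taken to be $+\infty$ if the reduced pencil is not regular) and a finite maximizer $\omega^{(j)}$ of $\sigma(\mu^{(j)},\cdot)$ with $D(\mu^{(j)},\mathrm i\omega^{(j)})$ invertible; let $V_j,W_j$ (orthonormal columns, equally many) be such that $\operatorname{Col}V_j=\operatorname{Col}V_{j-1}+\operatorname{Col}\widetilde V$ and $\operatorname{Col}W_j=\operatorname{Col}W_{j-1}+\operatorname{Col}\widetilde W$, where, with everything evaluated at $(\mu^{(j)},\mathrm i\omega^{(j)})$, $\widetilde V=D^{-1}B$ if $m\le p$ and $\widetilde V=D^{-1}BH^*$ if $m>p$, while $\widetilde W=D^{-*}C^*$ if $m\ge p$ and $\widetilde W=D^{-*}C^*H$ if $m<p$. In the *extended* algorithm, for $j\ge2$, the subspaces are moreover enlarged in the same way by the matrices $\widetilde V,\widetilde W$ evaluated at $(\mu^{(j,rq)},\mathrm i\omega^{(j,rq)})$,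 $1\le r\le q\le d$, where $\mu^{(j,rq)}=\mu^{(j)}+\|\mu^{(j)}-\mu^{(j-1)}\|_2\,e_{rq}\in\Omega$, $e_{rr}=e_r$, $e_{rq}=(e_r+e_q)/\sqrt2$ for $r\ne q$, and $\omega^{(j,rq)}$ is a finite maximizer of $\sigma(\mu^{(j,rq)},\cdot)$ with $D(\mu^{(j,rq)},\mathrm i\omega^{(j,rq)})$ invertible. Fix $k\ge1$ and a family of ($k$-step) runs of one of the two algorithms such that $\mu^{(k)}\to\mu_*$ as $\mu^{(1)}\to\mu_*$ and in which the sign of $\omega^{(k)}$ is chosen so that $\omega_*\omega^{(k)}\ge0$. Let $\delta<0$, $\beta>0$ satisfy $\sigma_{\omega\omega}(\mu_*,\omega_*)\le\delta$ and $\sigma_{\min}(D(\mu_*,\mathrm i\omega_*))\ge\beta$. For $\rho>0$ call a run of the family *$\rho$-admissible* if $$\|\mu^{(1)}-\mu_*\|_2<\rho,\qquad \sigma^{V_k,W_k}_{\omega\omega}(\mu_*,\omega_*)\le\delta,\qquad \sigma_{\min}\big(D^{V_k,W_k}(\mu_*,\mathrm i\omega_*)\big)\ge\beta .$$ **Lemma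 (uniform boundedness of higher-order derivatives).** There are $\rho,\eta_{\mu,0},\eta_{\omega,0},\varepsilon>0$, common to all runs of the family, such that, with $\overline{\mathcal B}_\mu=\overline{\mathcal B}(\mu_*,\eta_{\mu,0})$ and $\overline{\mathcal B}_\omega=\overline{\mathcal B}(\omega_*,\eta_{\omega,0})$, the following holds. (a) There is a unique continuous $\boldsymbol\omega:\overline{\mathcal B}_\mu\to\overline{\mathcal B}_\omega$ with $\boldsymbol\omega(\mu_*)=\omega_*$ and $\sigma_\omega(\mu,\boldsymbol\omega(\mu))=0$ for all $\mu\in\overline{\mathcal B}_\mu$. It is $C^3$ in the interior, and on $\overline{\mathcal B}_\mu$ we have $\sigma_{\omega\omega}(\mu,\boldsymbol\omega(\mu))\le\delta/2$, $(\sigma-\sigma_2)(\mu,\boldsymbol\omega(\mu))\ge\varepsilon$, $\boldsymbol\omega(\mu)$ is, uniquely up to sign, the global maximizer of $\sigma(\mu,\cdot)$ on $\mathbb R$, and $\|H[\mu]\|_{\mathcal H_\infty}=\sigma(\mu,\boldsymbol\omega(\mu))$. The function $\|H[\cdot]\|_{\mathcal H_\infty}$ is $C^3$ in the interior of $\overline{\mathcal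 B}_\mu$. (b) For every $\rho$-admissible run, $\mu^{(k)}\in\overline{\mathcal B}_\mu$ and there is a unique continuous $\boldsymbol\omega^{V_k,W_k}:\overline{\mathcal B}_\mu\to\overline{\mathcal B}_\omega$ with $\boldsymbol\omega^{V_k,W_k}(\mu^{(k)})=\omega^{(k)}$ and $\sigma^{V_k,W_k}_\omega(\mu,\boldsymbol\omega^{V_k,W_k}(\mu))=0$ for all $\mu\in\overline{\mathcal B}_\mu$. It is $C^3$ in the interior, and on $\overline{\mathcal B}_\mu$ we have $\sigma^{V_k,W_k}_{\omega\omega}(\mu,\boldsymbol\omega^{V_k,W_k}(\mu))\le\delta/2$, $(\sigma^{V_k,W_k}-\sigma^{V_k,W_k}_2)(\mu,\boldsymbol\omega^{V_k,W_k}(\mu))\ge\varepsilon$, and $\boldsymbol\omega^{V_k,W_k}(\mu)$ is the unique maximizer and the unique stationary point of $\sigma^{V_k,W_k}(\mu,\cdot)$ in $\overline{\mathcal B}_\omega$. The function $\widetilde\sigma^{V_k,W_k}(\mu)=\sigma^{V_k,W_k}(\mu,\boldsymbol\omega^{V_k,W_k}(\mu))$ is $C^3$ in the interior of $\overline{\mathcal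 B}_\mu$. (c) For every $\widehat\eta\in(0,\eta_{\mu,0})$ there is $\gamma>0$, independent of the run (in particular of $\mu^{(1)}$), such that for all $\mu\in\overline{\mathcal B}(\mu_*,\widehat\eta)$, all $\rho$-admissible runs and all $q,r,\ell\in\{1,\dots,d\}$ $$\Big|\frac{\partial^2\|H[\mu]\|_{\mathcal H_\infty}}{\partial\mu_q\partial\mu_r}\Big|\le\gamma,\quad \big|\widetilde\sigma^{V_k,W_k}_{\mu_q\mu_r}(\mu)\big|\le\gamma,\quad \Big|\frac{\partial^3\|H[\mu]\|_{\mathcal H_\infty}}{\partial\mu_q\partial\mu_r\partial\mu_\ell}\Big|\le\gamma,\quad \big|\widetilde\sigma^{V_k,W_k}_{\mu_q\mu_r\mu_\ell}(\mu)\big|\le\gamma .$$ -/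

import Mathlib

open Set Filter Topology Metric
open scoped Matrix ENNReal

noncomputable section

/-- The parameter space `ℝ^d` with the Euclidean norm. -/
abbrev Par (d : ℕ) : Type := EuclideanSpace ℝ (Fin d)

/-- The `i`-th largest singular value of a complex matrix, counted from `i = 0`
(and `0` for an index beyond the number of singular values). -/
def singVal {a b : ℕ} (M : Matrix (Fin a) (Fin b) ℂ) (i : ℕ) : ℝ :=
  (Matrix.toEuclideanLin M).singularValues i

/-- The largest singular value, i.e. the spectral norm. -/
def sigMax {a b : ℕ} (M : Matrix (Fin a) (Fin b) ℂ) : ℝ := singVal M 0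

/-- The second largest singular value. -/
def sigSnd {a b : ℕ} (M : Matrix (Fin a) (Fin b) ℂ) : ℝ := singVal M 1

/-- The smallest singular value of a square matrix (`0` for the empty matrix). -/
def sigMin {a : ℕ} (M : Matrix (Fin a) (Fin a) ℂ) : ℝ := singVal M (a - 1)

/-- The column space of a matrix. -/
def colSpace {a b : ℕ} (M : Matrix (Fin a) (Fin b) ℂ) : Submodule ℂ (Fin a → ℂ) :=
  LinearMap.range M.mulVecLin

/-- The partial derivative of `f : ℝ^d → ℝ` in the `q`-th coordinate. -/
def partialD {d : ℕ} (q : Fin d) (f : Par d → ℝ) : Par d → ℝ :=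
  fun μ => lineDeriv ℝ f μ (EuclideanSpace.single q 1)

/-- The data of a parameter-dependent descriptor system with `d` parameters, order `n`, `m` inputs
and `p` outputs, whose coefficients are combinations of fixed real matrices with real-analytic
coefficient functions on an open bounded set `Ω`. -/
structure ParamSystem (d n m p : ℕ) where
  Ω : Set (Par d)
  isOpen : IsOpen Ω
  isBounded : Bornology.IsBounded Ω
  κE : ℕ
  κA : ℕ
  κB : ℕ
  κC : ℕ
  f : Fin κE → Par d → ℝ
  g : Fin κA → Par d → ℝ
  h : Fin κB → Par d → ℝ
  l : Fin κC → Par d → ℝ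
  f_analytic : ∀ i, AnalyticOnNhd ℝ (f i) Ω
  g_analytic : ∀ i, AnalyticOnNhd ℝ (g i) Ω
  h_analytic : ∀ i, AnalyticOnNhd ℝ (h i) Ω
  l_analytic : ∀ i, AnalyticOnNhd ℝ (l i) Ω
  Emat : Fin κE → Matrix (Fin n) (Fin n) ℝ
  Amat : Fin κA → Matrix (Fin n) (Fin n) ℝ
  Bmat : Fin κB → Matrix (Fin n) (Fin m) ℝ
  Cmat : Fin κC → Matrix (Fin p) (Fin n) ℝ

namespace ParamSystem

variable {d n m p : ℕ} (S : ParamSystem d n m p)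

/-- `E(μ)`, as a complex matrix. -/
def E (μ : Par d) : Matrix (Fin n) (Fin n) ℂ := (∑ i, S.f i μ • S.Emat i).map Complex.ofReal

/-- `A(μ)`, as a complex matrix. -/
def A (μ : Par d) : Matrix (Fin n) (Fin n) ℂ := (∑ i, S.g i μ • S.Amat i).map Complex.ofReal

/-- `B(μ)`, as a complex matrix. -/
def B (μ : Par d) : Matrix (Fin n) (Fin m) ℂ := (∑ i, S.h i μ • S.Bmat i).map Complex.ofReal

/-- `C(μ)`, as a complex matrix. -/
def C (μ : Par d) : Matrix (Fin p) (Fin n) ℂ := (∑ i, S.l i μ • S.Cmat i).map Complex.ofReal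

/-- `D(μ, s) = s E(μ) - A(μ)`. -/
def D (μ : Par d) (s : ℂ) : Matrix (Fin n) (Fin n) ℂ := s • S.E μ - S.A μ

/-- The transfer function `H[μ](s) = C(μ) D(μ, s)⁻¹ B(μ)`. -/
def H (μ : Par d) (s : ℂ) : Matrix (Fin p) (Fin m) ℂ := S.C μ * (S.D μ s)⁻¹ * S.B μ

/-- `σ(μ, ω)`, the largest singular value of `H[μ](iω)`. -/
def sigma (μ : Par d) (ω : ℝ) : ℝ := sigMax (S.H μ (Complex.I * ω))

/-- `σ₂(μ, ω)`, the second largest singular value of `H[μ](iω)`. -/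
def sigma2 (μ : Par d) (ω : ℝ) : ℝ := sigSnd (S.H μ (Complex.I * ω))

/-- `σ(μ, ·)` on `ℝ ∪ {∞}`: the limit of `σ(μ, ω)` as `ω → x`, `ω ≠ x`. If `H[μ]` is bounded on the
imaginary axis, this is the largest singular value of the rational function `H[μ]` at `ix`, also for
`x = ∞` and at removable singularities; where `D(μ, ix)` is invertible it equals `σ(μ, x)`. -/
def sigmaExt (μ : Par d) (x : OnePoint ℝ) : ℝ :=
  limUnder (comap ((↑) : ℝ → OnePoint ℝ) (𝓝[≠] x)) (S.sigma μ)

/-- The pencil `s E(μ) - A(μ)` is regular. -/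
def Regular (μ : Par d) : Prop := ∃ s : ℂ, (S.D μ s).det ≠ 0

/-- The supremum of `‖H[μ](s)‖₂` over the open right half-plane, as an extended number. (For a
regular pencil `D(μ, s)` is singular for finitely many `s` only. These do not change the supremum:
`H[μ]` is unbounded near its poles, and is continuous near a removable singularity.) -/
def hinfENorm (μ : Par d) : ℝ≥0∞ :=
  ⨆ s : {s : ℂ // 0 < s.re}, ENNReal.ofReal (sigMax (S.H μ s))

/-- The `H∞`-norm of `H[μ]`. -/
def hinfNorm (μ : Par d) : ℝ := (S.hinfENorm μ).toReal

/-- `H[μ]` is well defined and belongs to `H∞`. -/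
def InHinf (μ : Par d) : Prop := S.Regular μ ∧ S.hinfENorm μ < ⊤

/-! ### Reduced systems

`V` and `W` hold orthonormal bases of the two subspaces in their columns. By linearity, the reduced
coefficients are the full ones multiplied by `Wᴴ` from the left and by `V` from the right. -/

/-- `D^{V,W}(μ, s)`. -/
def redD {r : ℕ} (V W : Matrix (Fin n) (Fin r) ℂ) (μ : Par d) (s : ℂ) :
    Matrix (Fin r) (Fin r) ℂ :=
  s • (Wᴴ * S.E μ * V) - Wᴴ * S.A μ * V

/-- The reduced transfer function `C^V(μ) D^{V,W}(μ, s)⁻¹ B^W(μ)`. -/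
def redH {r : ℕ} (V W : Matrix (Fin n) (Fin r) ℂ) (μ : Par d) (s : ℂ) :
    Matrix (Fin p) (Fin m) ℂ :=
  (S.C μ * V) * (S.redD V W μ s)⁻¹ * (Wᴴ * S.B μ)

/-- `σ^{V,W}(μ, ω)`. -/
def redSigma {r : ℕ} (V W : Matrix (Fin n) (Fin r) ℂ) (μ : Par d) (ω : ℝ) : ℝ :=
  sigMax (S.redH V W μ (Complex.I * ω))

/-- `σ₂^{V,W}(μ, ω)`. -/
def redSigma2 {r : ℕ} (V W : Matrix (Fin n) (Fin r) ℂ) (μ : Par d) (ω : ℝ) : ℝ :=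
  sigSnd (S.redH V W μ (Complex.I * ω))

open Classical in
/-- The norm of the reduced transfer function that the algorithms minimize: the supremum of
`σ^{V,W}(μ, ·)` on the imaginary axis (reduced systems need not be stable), and `∞` if the reduced
pencil is not regular. -/
def redNorm {r : ℕ} (V W : Matrix (Fin n) (Fin r) ℂ) (μ : Par d) : ℝ≥0∞ :=
  if ∃ s : ℂ, (S.redD V W μ s).det ≠ 0 then ⨆ ω : ℝ, ENNReal.ofReal (S.redSigma V W μ ω) else ⊤

/-! ### The two greedy algorithms -/

/-- `ω` is a (finite) maximizer of `σ(μ, ·)` at which `D(μ, iω)` can be inverted. -/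
def IsMaxFreq (μ : Par d) (ω : ℝ) : Prop :=
  μ ∈ S.Ω ∧ IsUnit (S.D μ (Complex.I * ω)).det ∧ ∀ ω' : ℝ, S.sigma μ ω' ≤ S.sigma μ ω

/-- The space by which the right subspace is expanded for interpolation at `(μ, iω)`. -/
def expandV (μ : Par d) (ω : ℝ) : Submodule ℂ (Fin n → ℂ) :=
  if p < m then
    colSpace ((S.D μ (Complex.I * ω))⁻¹ * S.B μ * (S.H μ (Complex.I * ω))ᴴ)
  else colSpace ((S.D μ (Complex.I * ω))⁻¹ * S.B μ)

/-- The space by which the left subspace is expanded for interpolation at `(μ, iω)`. -/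
def expandW (μ : Par d) (ω : ℝ) : Submodule ℂ (Fin n → ℂ) :=
  if m < p then
    colSpace (((S.D μ (Complex.I * ω))ᴴ)⁻¹ * (S.C μ)ᴴ * S.H μ (Complex.I * ω))
  else colSpace (((S.D μ (Complex.I * ω))ᴴ)⁻¹ * (S.C μ)ᴴ)

end ParamSystem

/-- The direction `e_{rq}`: `e_r` if `r = q`, and `(e_r + e_q)/√2` otherwise. -/
def eDir {d : ℕ} (r q : Fin d) : Par d :=
  if r = q then EuclideanSpace.single r 1
  else (1 / Real.sqrt 2) • (EuclideanSpace.single r 1 + EuclideanSpace.single q 1)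

/-- The two algorithms: the basic one, and the extended one, which interpolates also at points
close to the iterates. -/
inductive Variant
  | basic
  | extended

/-- The quantities that a run of one of the algorithms produces: basis matrices `V j`, `W j` of the
subspaces after step `j` (initial ones for `j = 0`) and their common dimension `r j`, the
iterates `μ j` and `ω j` of step `j ≥ 1`, and the maximizers `ωx j a b` at the neighbouring points of
the extended algorithm. -/
structure GreedyData (d n : ℕ) where
  r : ℕ → ℕ
  V : (j : ℕ) → Matrix (Fin n) (Fin (r j)) ℂ
  W : (j : ℕ) → Matrix (Fin n) (Fin (r j)) ℂ
  μ : ℕ → Par d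
  ω : ℕ → ℝ
  ωx : ℕ → Fin d → Fin d → ℝ

namespace GreedyData

variable {d n m p : ℕ}

/-- The neighbouring point `μ^{(j,ab)} = μ^{(j)} + ‖μ^{(j)} - μ^{(j-1)}‖ e_{ab}`. -/
def μx (R : GreedyData d n) (j : ℕ) (a b : Fin d) : Par d :=
  R.μ j + ‖R.μ j - R.μ (j - 1)‖ • eDir a b

/-- The expansion of the right subspace in step `j`. -/
def stepV (R : GreedyData d n) (S : ParamSystem d n m p) (j : ℕ) :
    Variant → Submodule ℂ (Fin n → ℂ)
  | .basic => S.expandV (R.μ j) (R.ω j)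
  | .extended => S.expandV (R.μ j) (R.ω j) ⊔
      ⨆ (a : Fin d) (b : Fin d) (_ : 2 ≤ j ∧ a ≤ b), S.expandV (R.μx j a b) (R.ωx j a b)

/-- The expansion of the left subspace in step `j`. -/
def stepW (R : GreedyData d n) (S : ParamSystem d n m p) (j : ℕ) :
    Variant → Submodule ℂ (Fin n → ℂ)
  | .basic => S.expandW (R.μ j) (R.ω j)
  | .extended => S.expandW (R.μ j) (R.ω j) ⊔
      ⨆ (a : Fin d) (b : Fin d) (_ : 2 ≤ j ∧ a ≤ b), S.expandW (R.μx j a b) (R.ωx j a b)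

/-- `R` records the first `k` steps of a run of the algorithm `alg` for the minimization of
`‖H[·]‖` over `K`. -/
structure IsRun (R : GreedyData d n) (S : ParamSystem d n m p) (K : Set (Par d)) (alg : Variant)
    (k : ℕ) : Prop where
  orthV : ∀ j ≤ k, (R.V j)ᴴ * R.V j = 1
  orthW : ∀ j ≤ k, (R.W j)ᴴ * R.W j = 1
  mem : ∀ j < k, R.μ (j + 1) ∈ K
  argmin : ∀ j < k, IsMinOn (S.redNorm (R.V j) (R.W j)) K (R.μ (j + 1))
  argmax : ∀ j < k, S.IsMaxFreq (R.μ (j + 1)) (R.ω (j + 1))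
  argmaxx : alg = .extended → ∀ j < k, 2 ≤ j + 1 → ∀ a b : Fin d, a ≤ b →
    S.IsMaxFreq (R.μx (j + 1) a b) (R.ωx (j + 1) a b)
  colV : ∀ j < k, colSpace (R.V (j + 1)) = colSpace (R.V j) ⊔ R.stepV S (j + 1) alg
  colW : ∀ j < k, colSpace (R.W (j + 1)) = colSpace (R.W j) ⊔ R.stepW S (j + 1) alg

end GreedyData

/-- `w` is a continuous function from the closed ball of radius `ημ` around `μs` to the closed
interval of radius `ηω` around `ωs`, with `w μ₀ = ω₀` and `∂g/∂ω (μ, w μ) = 0` on the ball. -/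
structure IsCritBranch {d : ℕ} (g : Par d → ℝ → ℝ) (μs : Par d) (ωs ημ ηω : ℝ)
    (μ₀ : Par d) (ω₀ : ℝ) (w : Par d → ℝ) : Prop where
  cont : ContinuousOn w (closedBall μs ημ)
  maps : MapsTo w (closedBall μs ημ) (closedBall ωs ηω)
  base_mem : μ₀ ∈ closedBall μs ημ
  base : w μ₀ = ω₀
  crit : ∀ μ ∈ closedBall μs ημ, HasDerivAt (g μ) 0 (w μ)

end

/-!
A simple largest singular value is a smooth function of the matrix, because its square is a simple
root of the characteristic polynomial of `HᴴH`. On a small rectangle around `(μs, ωs)` on which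
`σ_{ωω} ≤ δ/2`, the implicit function theorem for `σ_ω = 0` therefore yields the `C³` branches, and
strict concavity in `ω` yields their uniqueness and maximality.

The rectangle and the bounds do not depend on the run, since for each of the finitely many orders
`r ≤ n` the admissible pairs `(V, W)` of orthonormal bases (with `σ_min ≥ β`, a gap `σ - σ₂` bounded
below and `σ_{ωω} ≤ δ` at `(μs, ωs)`) form a compact set. The full system is the pair `(1, 1)` of
order `n`. The reduced branch may start at `(μ^(k), ω^(k))` because the subspaces make `σ` and
`σ^{V,W}` agree there to first order in `ω`.

By the Phragmén–Lindelöf principle, the `H∞`-norm is the maximum of `σ` on the imaginary axis.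
-/

/-! ### Singular values -/

theorem exists_ne_zero_forall_inner_eq_zero {𝕜 E ι : Type*} [RCLike 𝕜]
    [NormedAddCommGroup E] [InnerProductSpace 𝕜 E] [Fintype ι] (v : ι → E)
    (hι : Fintype.card ι < Module.finrank 𝕜 E) : ∃ x ≠ 0, ∀ i, inner 𝕜 (v i) x = 0 := by
  have : FiniteDimensional 𝕜 E := FiniteDimensional.of_finrank_pos (by omega)
  obtain ⟨x, hx, hx0⟩ := Submodule.exists_mem_ne_zero_of_ne_bot
    ((LinearMap.pi fun i ↦ innerₛₗ 𝕜 (v i)).ker_ne_bot_of_finrank_lt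
      (by rwa [Module.finrank_fintype_fun_eq_card]))
  exact ⟨x, hx0, fun i ↦ congrFun hx i⟩

section SingularValues

variable {𝕜 E F : Type*} [RCLike 𝕜] [NormedAddCommGroup E] [InnerProductSpace 𝕜 E]
  [FiniteDimensional 𝕜 E] [NormedAddCommGroup F] [InnerProductSpace 𝕜 F] [FiniteDimensional 𝕜 F]

/-- An orthonormal basis of right singular vectors of `T`, in the order of decreasing singular
values. -/
noncomputable def rightSingularBasis (T : E →ₗ[𝕜] F) :
    OrthonormalBasis (Fin (Module.finrank 𝕜 E)) 𝕜 E :=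
  T.isSymmetric_adjoint_comp_self.eigenvectorBasis rfl

theorem norm_map_sq_eq_sum_singularValues (T : E →ₗ[𝕜] F) (x : E) :
    ‖T x‖ ^ 2 = ∑ i : Fin (Module.finrank 𝕜 E),
      T.singularValues i ^ 2 * ‖inner 𝕜 (rightSingularBasis T i) x‖ ^ 2 := by
  have coord : ∀ i, inner 𝕜 (rightSingularBasis T i) ((T.adjoint ∘ₗ T) x)
      = (T.singularValues i ^ 2 : ℝ) * inner 𝕜 (rightSingularBasis T i) x := by
    intro i
    have h := T.isSymmetric_adjoint_comp_self.eigenvectorBasis_apply_self_apply rfl x i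
    rwa [OrthonormalBasis.repr_apply_apply, OrthonormalBasis.repr_apply_apply,
      ← T.sq_singularValues_fin] at h
  have expansion : ((‖T x‖ ^ 2 : ℝ) : 𝕜) = ((∑ i : Fin (Module.finrank 𝕜 E),
      T.singularValues i ^ 2 * ‖inner 𝕜 (rightSingularBasis T i) x‖ ^ 2 : ℝ) : 𝕜) := by
    rw [RCLike.ofReal_pow, ← inner_self_eq_norm_sq_to_K, ← T.adjoint_inner_right,
      ← LinearMap.comp_apply, ← (rightSingularBasis T).sum_inner_mul_inner, RCLike.ofReal_sum]
    refine Finset.sum_congr rfl fun i _ ↦ ?_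
    rw [coord, RCLike.ofReal_mul, RCLike.ofReal_pow ‖_‖, ← RCLike.mul_conj, inner_conj_symm]
    ring
  exact RCLike.ofReal_injective expansion

theorem norm_map_le_singularValues_mul (T : E →ₗ[𝕜] F) {j : ℕ} {x : E}
    (hx : ∀ i : Fin (Module.finrank 𝕜 E), (i : ℕ) < j → inner 𝕜 (rightSingularBasis T i) x = 0) :
    ‖T x‖ ≤ T.singularValues j * ‖x‖ := by
  refine le_of_sq_le_sq ?_ (mul_nonneg (T.singularValues_nonneg j) (norm_nonneg x))
  rw [norm_map_sq_eq_sum_singularValues, mul_pow,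
    ← (rightSingularBasis T).sum_sq_norm_inner_right x, Finset.mul_sum]
  refine Finset.sum_le_sum fun i _ ↦ ?_
  rcases lt_or_ge (i : ℕ) j with hij | hij
  · simp [hx i hij]
  · exact mul_le_mul_of_nonneg_right (pow_le_pow_left₀ (T.singularValues_nonneg _)
      (T.singularValues_antitone hij) 2) (sq_nonneg _)

theorem singularValues_mul_le_norm_map (T : E →ₗ[𝕜] F) {j : ℕ} {x : E}
    (hx : ∀ i : Fin (Module.finrank 𝕜 E), j < (i : ℕ) → inner 𝕜 (rightSingularBasis T i) x = 0) :
    T.singularValues j * ‖x‖ ≤ ‖T x‖ := by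
  refine le_of_sq_le_sq ?_ (norm_nonneg _)
  rw [norm_map_sq_eq_sum_singularValues, mul_pow,
    ← (rightSingularBasis T).sum_sq_norm_inner_right x, Finset.mul_sum]
  refine Finset.sum_le_sum fun i _ ↦ ?_
  rcases lt_or_ge j (i : ℕ) with hij | hij
  · simp [hx i hij]
  · exact mul_le_mul_of_nonneg_right (pow_le_pow_left₀ (T.singularValues_nonneg _)
      (T.singularValues_antitone hij) 2) (sq_nonneg _)

theorem singularValues_zero_eq_opNorm (T : E →ₗ[𝕜] F) :
    T.singularValues 0 = ‖T.toContinuousLinearMap‖ := by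
  refine le_antisymm ?_ (ContinuousLinearMap.opNorm_le_bound _ (T.singularValues_nonneg 0)
    fun x ↦ norm_map_le_singularValues_mul T fun i hi ↦ absurd hi (Nat.not_lt_zero _))
  rcases Nat.eq_zero_or_pos (Module.finrank 𝕜 E) with hE | hE
  · rw [T.singularValues_of_finrank_le hE.le]
    exact norm_nonneg _
  · have h₁ := singularValues_mul_le_norm_map T (j := 0) (x := rightSingularBasis T ⟨0, hE⟩)
      fun i hi ↦ (rightSingularBasis T).orthonormal.2 fun e ↦ by simp [e] at hi
    have h₂ := T.toContinuousLinearMap.le_opNorm (rightSingularBasis T ⟨0, hE⟩)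
    rw [OrthonormalBasis.norm_eq_one, mul_one] at h₁ h₂
    exact h₁.trans h₂

theorem singularValues_le_add_opNorm_sub (T S : E →ₗ[𝕜] F) (j : ℕ) :
    T.singularValues j ≤ S.singularValues j + ‖(T - S).toContinuousLinearMap‖ := by
  rcases Nat.lt_or_ge j (Module.finrank 𝕜 E) with hj | hj
  · obtain ⟨x, hx0, hx⟩ := exists_ne_zero_forall_inner_eq_zero (𝕜 := 𝕜)
      (fun i : {i : Fin (Module.finrank 𝕜 E) // i ≠ ⟨j, hj⟩} ↦
        if j < i.1 then rightSingularBasis T i.1 else rightSingularBasis S i.1)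
      (by rw [Fintype.card_subtype_compl, Fintype.card_fin, Fintype.card_unique]; omega)
    have hT := singularValues_mul_le_norm_map T (j := j) (x := x) fun i hi ↦ by
      simpa only [if_pos hi] using hx ⟨i, fun e ↦ by simp [e] at hi⟩
    have hS := norm_map_le_singularValues_mul S (j := j) (x := x) fun i hi ↦ by
      simpa only [if_neg hi.not_gt] using hx ⟨i, fun e ↦ by simp [e] at hi⟩
    have hsub : ‖T x - S x‖ ≤ ‖(T - S).toContinuousLinearMap‖ * ‖x‖ :=
      (T - S).toContinuousLinearMap.le_opNorm x
    refine le_of_mul_le_mul_right ?_ (norm_pos_iff.2 hx0)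
    linarith [norm_le_norm_add_norm_sub (S x) (T x), norm_sub_rev (S x) (T x)]
  · rw [T.singularValues_of_finrank_le hj, S.singularValues_of_finrank_le hj, zero_add]
    exact norm_nonneg _

end SingularValues

section MatrixSingularValues

open scoped Matrix.Norms.L2Operator

variable {a b : ℕ}

theorem singVal_nonneg (M : Matrix (Fin a) (Fin b) ℂ) (i : ℕ) : 0 ≤ singVal M i :=
  M.toEuclideanLin.singularValues_nonneg i

theorem sigMax_eq_norm (M : Matrix (Fin a) (Fin b) ℂ) : sigMax M = ‖M‖ :=
  singularValues_zero_eq_opNorm M.toEuclideanLin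

theorem singVal_le_add_norm_sub (M N : Matrix (Fin a) (Fin b) ℂ) (i : ℕ) :
    singVal M i ≤ singVal N i + ‖M - N‖ := by
  rw [Matrix.l2_opNorm_def, map_sub]
  exact singularValues_le_add_opNorm_sub _ _ i

theorem lipschitzWith_singVal (i : ℕ) :
    LipschitzWith 1 fun M : Matrix (Fin a) (Fin b) ℂ ↦ singVal M i :=
  LipschitzWith.of_le_add fun M N ↦ dist_eq_norm M N ▸ singVal_le_add_norm_sub M N i

theorem continuous_singVal (i : ℕ) :
    Continuous fun M : Matrix (Fin a) (Fin b) ℂ ↦ singVal M i :=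
  (lipschitzWith_singVal i).continuous

theorem sigMin_mul_norm_le (M : Matrix (Fin a) (Fin a) ℂ) (x : EuclideanSpace ℂ (Fin a)) :
    sigMin M * ‖x‖ ≤ ‖M.toEuclideanLin x‖ :=
  singularValues_mul_le_norm_map M.toEuclideanLin fun i hi ↦ by
    have := i.2.trans_eq finrank_euclideanSpace_fin
    omega

theorem det_ne_zero_of_mul_norm_le {β : ℝ} (hβ : 0 < β) {M : Matrix (Fin a) (Fin a) ℂ}
    (hM : ∀ x : EuclideanSpace ℂ (Fin a), β * ‖x‖ ≤ ‖M.toEuclideanLin x‖) : M.det ≠ 0 := by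
  intro h0
  obtain ⟨v, hv, hMv⟩ := Matrix.exists_mulVec_eq_zero_iff.2 h0
  have hle : β * ‖WithLp.toLp 2 v‖ ≤ 0 := by
    simpa [Matrix.toLpLin_toLp, hMv] using hM (WithLp.toLp 2 v)
  have hpos : 0 < ‖WithLp.toLp 2 v‖ := norm_pos_iff.2 (by simpa using hv)
  exact hle.not_gt (mul_pos hβ hpos)

theorem norm_toLp_star (v : Fin a → ℂ) : ‖WithLp.toLp 2 (star v)‖ = ‖WithLp.toLp 2 v‖ := by
  simp [EuclideanSpace.norm_eq]

theorem sigMax_map_star_le (M : Matrix (Fin a) (Fin b) ℂ) : sigMax (M.map star) ≤ sigMax M := by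
  rw [sigMax_eq_norm, sigMax_eq_norm, Matrix.l2_opNorm_def (M.map star)]
  refine ContinuousLinearMap.opNorm_le_bound _ (norm_nonneg _) fun x ↦ ?_
  have mulVec_star : M.map star *ᵥ x.ofLp = star (M *ᵥ star x.ofLp) := by
    ext i
    simp [Matrix.mulVec, dotProduct]
  calc ‖M.map star |>.toEuclideanLin x‖ = ‖WithLp.toLp 2 (M *ᵥ star x.ofLp)‖ := by
        rw [Matrix.toLpLin_apply, mulVec_star, norm_toLp_star]
    _ ≤ ‖M‖ * ‖WithLp.toLp 2 (star x.ofLp)‖ := M.l2_opNorm_mulVec _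
    _ = ‖M‖ * ‖x‖ := by rw [norm_toLp_star]

theorem sigMax_map_star (M : Matrix (Fin a) (Fin b) ℂ) : sigMax (M.map star) = sigMax M := by
  refine le_antisymm (sigMax_map_star_le M) ?_
  simpa [Function.comp_def] using sigMax_map_star_le (M.map star)

theorem charpoly_conjTranspose_mul_self (M : Matrix (Fin a) (Fin b) ℂ) :
    (Mᴴ * M).charpoly
      = ∏ i : Fin b, (Polynomial.X - Polynomial.C ((singVal M i ^ 2 : ℝ) : ℂ)) := by
  have adjoint_comp : M.toEuclideanLin.adjoint ∘ₗ M.toEuclideanLin = (Mᴴ * M).toEuclideanLin := by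
    rw [← Matrix.toEuclideanLin_conjTranspose_eq_adjoint]
    ext x : 1
    simp [Matrix.toLpLin_apply]
  rw [← Matrix.charpoly_toLin (Mᴴ * M) (PiLp.basisFun 2 ℂ (Fin b)), ← Matrix.toLpLin_eq_toLin,
    ← adjoint_comp, M.toEuclideanLin.isSymmetric_adjoint_comp_self.charpoly_eq
      finrank_euclideanSpace_fin]
  refine Finset.prod_congr rfl fun i _ ↦ ?_
  rw [singVal, M.toEuclideanLin.sq_singularValues_fin finrank_euclideanSpace_fin]
  rfl

end MatrixSingularValues

section PartialDerivatives

variable {X : Type*} [NormedAddCommGroup X] [NormedSpace ℝ X] {F : X × ℝ → ℝ} {z : X × ℝ}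

/-- The partial derivative of a function on `X × ℝ` in the real variable. -/
noncomputable def derivSnd {X : Type*} (F : X × ℝ → ℝ) (z : X × ℝ) : ℝ :=
  deriv (fun t ↦ F (z.1, t)) z.2

theorem hasDerivAt_fderiv_inr (hF : DifferentiableAt ℝ F z) :
    HasDerivAt (fun t ↦ F (z.1, t)) (fderiv ℝ F z (0, 1)) z.2 :=
  hF.hasFDerivAt.comp_hasDerivAt z.2 ((hasDerivAt_const z.2 z.1).prodMk (hasDerivAt_id z.2))

theorem derivSnd_eq_fderiv (hF : DifferentiableAt ℝ F z) : derivSnd F z = fderiv ℝ F z (0, 1) :=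
  (hasDerivAt_fderiv_inr hF).deriv

theorem hasDerivAt_derivSnd (hF : DifferentiableAt ℝ F z) :
    HasDerivAt (fun t ↦ F (z.1, t)) (derivSnd F z) z.2 :=
  (hasDerivAt_fderiv_inr hF).differentiableAt.hasDerivAt

theorem contDiffAt_derivSnd {k : ℕ} (hF : ContDiffAt ℝ (k + 1 : ℕ) F z) :
    ContDiffAt ℝ k (derivSnd F) z := by
  have hF' : ContDiffAt ℝ k (fun y ↦ fderiv ℝ F y (0, 1)) z :=
    (hF.fderiv_right (m := k) (by simp)).clm_apply contDiffAt_const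
  refine hF'.congr_of_eventuallyEq ?_
  filter_upwards [hF.eventually (by simp)] with y hy
  exact derivSnd_eq_fderiv (hy.differentiableAt (by simp))

theorem exists_contDiffAt_implicitFunction [CompleteSpace X] {n : WithTop ℕ∞} (hn : n ≠ 0)
    (hF : ContDiffAt ℝ n F z) (hz : derivSnd F z ≠ 0) :
    ∃ ψ : X → ℝ, ψ z.1 = z.2 ∧ ContDiffAt ℝ n ψ z.1 ∧
      ∀ᶠ y in 𝓝 z, F y = F z ↔ ψ y.1 = y.2 := by
  rw [derivSnd_eq_fderiv (hF.differentiableAt hn)] at hz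
  have hinv : (fderiv ℝ F z ∘L .inr ℝ X ℝ).IsInvertible :=
    ⟨ContinuousLinearEquiv.unitsEquivAut ℝ (Units.mk0 _ hz), by ext; simp⟩
  exact ⟨hF.implicitFunction hn hinv, hF.implicitFunction_apply_self hn hinv,
    hF.contDiffAt_implicitFunction hn hinv,
    hF.eventually_apply_eq_iff_implicitFunction hn hinv⟩

end PartialDerivatives

section MatrixCalculus

open scoped Matrix.Norms.L2Operator

variable {ι κ l : Type*} [Fintype ι] [Fintype κ] [DecidableEq κ] [Fintype l] [DecidableEq l]
  {X : Type*} [NormedAddCommGroup X] [NormedSpace ℝ X] {n : WithTop ℕ∞} {x : X}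

theorem contDiffAt_matrix {f : X → Matrix ι κ ℂ} :
    ContDiffAt ℝ n f x ↔ ∀ i j, ContDiffAt ℝ n (fun y ↦ f y i j) x := by
  let e : Matrix ι κ ℂ ≃L[ℝ] (ι → κ → ℂ) :=
    (Matrix.ofLinearEquiv ℝ).symm.toContinuousLinearEquiv
  rw [← e.comp_contDiffAt_iff, contDiffAt_pi]
  exact forall_congr' fun i ↦ contDiffAt_pi

theorem contDiffAt_matrix_mul {f : X → Matrix ι κ ℂ} {g : X → Matrix κ l ℂ}
    (hf : ContDiffAt ℝ n f x) (hg : ContDiffAt ℝ n g x) :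
    ContDiffAt ℝ n (fun y ↦ f y * g y) x := by
  rw [contDiffAt_matrix] at *
  exact fun i j ↦ ContDiffAt.sum fun k _ ↦ (hf i k).mul (hg k j)

theorem contDiffAt_matrix_conjTranspose [DecidableEq ι] {f : X → Matrix ι κ ℂ}
    (hf : ContDiffAt ℝ n f x) : ContDiffAt ℝ n (fun y ↦ (f y)ᴴ) x := by
  rw [contDiffAt_matrix] at *
  exact fun i j ↦ Complex.conjCLE.contDiff.contDiffAt.comp x (hf j i)

theorem contDiffAt_matrix_det [DecidableEq ι] {f : X → Matrix ι ι ℂ} (hf : ContDiffAt ℝ n f x) :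
    ContDiffAt ℝ n (fun y ↦ (f y).det) x := by
  rw [contDiffAt_matrix] at hf
  simp only [Matrix.det_apply']
  exact ContDiffAt.sum fun s _ ↦ contDiffAt_const.mul (contDiffAt_prod fun i _ ↦ hf _ _)

theorem contDiffAt_matrix_inv [DecidableEq ι] {f : X → Matrix ι ι ℂ}
    (hf : ContDiffAt ℝ n f x) (hx : (f x).det ≠ 0) : ContDiffAt ℝ n (fun y ↦ (f y)⁻¹) x := by
  obtain ⟨u, hu⟩ := (Matrix.isUnit_iff_isUnit_det (f x)).2 hx.isUnit
  have hinv : ContDiffAt ℝ n Ring.inverse (f x) := hu ▸ contDiffAt_ringInverse ℝ u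
  simpa only [Matrix.nonsing_inv_eq_ringInverse, Function.comp_def] using hinv.comp x hf

end MatrixCalculus

section SmoothSingularValue

open scoped Matrix.Norms.L2Operator

variable {a b : ℕ}

/-- The characteristic polynomial of `MᴴM` (which is real on the real line) as a function of
`(M, t)`; the squares of the singular values of `M` are its zeros. -/
noncomputable def gramCharpoly (z : Matrix (Fin a) (Fin b) ℂ × ℝ) : ℝ :=
  ((z.2 : ℂ) • (1 : Matrix (Fin b) (Fin b) ℂ) - z.1ᴴ * z.1).det.re

theorem gramCharpoly_eq_prod (M : Matrix (Fin a) (Fin b) ℂ) (t : ℝ) :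
    gramCharpoly (M, t) = ∏ i : Fin b, (t - singVal M i ^ 2) := by
  have h := Matrix.eval_charpoly (Mᴴ * M) (t : ℂ)
  rw [charpoly_conjTranspose_mul_self, Polynomial.eval_prod] at h
  rw [gramCharpoly, Matrix.smul_one_eq_diagonal, ← Matrix.scalar_apply, ← h,
    ← Complex.ofReal_re (∏ i : Fin b, (t - singVal M i ^ 2)), Complex.ofReal_prod]
  simp only [Polynomial.eval_sub, Polynomial.eval_X, Polynomial.eval_C, Complex.ofReal_sub]

theorem contDiffAt_gramCharpoly {n : WithTop ℕ∞} (z : Matrix (Fin a) (Fin b) ℂ × ℝ) :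
    ContDiffAt ℝ n gramCharpoly z :=
  Complex.reCLM.contDiff.contDiffAt.comp z <| contDiffAt_matrix_det <|
    ((Complex.ofRealCLM.contDiff.contDiffAt.comp z contDiffAt_snd).smul contDiffAt_const).sub
      (contDiffAt_matrix_mul (contDiffAt_matrix_conjTranspose contDiffAt_fst) contDiffAt_fst)

theorem derivSnd_gramCharpoly (M : Matrix (Fin a) (Fin b) ℂ) (i : Fin b) :
    derivSnd gramCharpoly (M, singVal M i ^ 2)
      = ∏ j ∈ Finset.univ.erase i, (singVal M i ^ 2 - singVal M j ^ 2) := by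
  have hfun : (fun t ↦ gramCharpoly (M, t)) = fun t ↦ (t - singVal M i ^ 2) *
      ∏ j ∈ Finset.univ.erase i, (t - singVal M j ^ 2) := by
    funext t
    rw [gramCharpoly_eq_prod, ← Finset.mul_prod_erase _ _ (Finset.mem_univ i)]
  have hdiff : DifferentiableAt ℝ (fun t : ℝ ↦ ∏ j ∈ Finset.univ.erase i, (t - singVal M j ^ 2))
      (singVal M i ^ 2) := by fun_prop
  rw [derivSnd, hfun]
  refine (((hasDerivAt_id _).sub_const _).mul hdiff.hasDerivAt).deriv.trans ?_
  simp only [one_mul, sub_self, zero_mul, add_zero]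

theorem derivSnd_gramCharpoly_ne_zero {M : Matrix (Fin a) (Fin b) ℂ} (hM : sigSnd M < sigMax M)
    (hb : 0 < b) : derivSnd gramCharpoly (M, sigMax M ^ 2) ≠ 0 := by
  refine (derivSnd_gramCharpoly M ⟨0, hb⟩).trans_ne (Finset.prod_ne_zero_iff.2 fun i hi ↦ ?_)
  have hi1 : 1 ≤ (i : ℕ) := Nat.one_le_iff_ne_zero.2 fun h ↦ Finset.ne_of_mem_erase hi (Fin.ext h)
  have hlt : singVal M i < sigMax M :=
    (M.toEuclideanLin.singularValues_antitone hi1).trans_lt hM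
  exact (sub_pos.2 (pow_lt_pow_left₀ hlt (singVal_nonneg M i) two_ne_zero)).ne'

theorem contDiffAt_sigMax {n : WithTop ℕ∞} {M₀ : Matrix (Fin a) (Fin b) ℂ}
    (hM₀ : sigSnd M₀ < sigMax M₀) :
    ContDiffAt ℝ n (sigMax : Matrix (Fin a) (Fin b) ℂ → ℝ) M₀ := by
  have hpos : 0 < sigMax M₀ := (singVal_nonneg M₀ 1).trans_lt hM₀
  have hb : 0 < b := by
    refine Nat.pos_of_ne_zero fun hb ↦ hpos.ne' ?_
    exact M₀.toEuclideanLin.singularValues_of_finrank_le (by simp [hb])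
  have root (M : Matrix (Fin a) (Fin b) ℂ) : gramCharpoly (M, sigMax M ^ 2) = 0 := by
    rw [gramCharpoly_eq_prod]
    exact Finset.prod_eq_zero (Finset.mem_univ ⟨0, hb⟩) (sub_self _)
  obtain ⟨ψ, hψ₀, hψ, hiff⟩ := exists_contDiffAt_implicitFunction (n := max n 1) (by simp)
    (contDiffAt_gramCharpoly (M₀, sigMax M₀ ^ 2)) (derivSnd_gramCharpoly_ne_zero hM₀ hb)
  have hcont : Tendsto (fun M : Matrix (Fin a) (Fin b) ℂ ↦ (M, sigMax M ^ 2)) (𝓝 M₀)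
      (𝓝 (M₀, sigMax M₀ ^ 2)) :=
    (continuous_id.prodMk ((continuous_singVal 0).pow 2)).tendsto M₀
  have heq : sigMax =ᶠ[𝓝 M₀] fun M ↦ √(ψ M) := by
    filter_upwards [hcont.eventually hiff] with M hM
    rw [hM.1 ((root M).trans (root M₀).symm)]
    exact (Real.sqrt_sq (singVal_nonneg M 0)).symm
  refine ((hψ.sqrt ?_).congr_of_eventuallyEq heq).of_le (le_max_left n 1)
  exact hψ₀.trans_ne (pow_pos hpos 2).ne'

end SmoothSingularValue

/-! ### Branches of critical points -/

section ConcaveFunctions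

variable {g g' : ℝ → ℝ} {s : Set ℝ} {w t : ℝ}

theorem lt_of_strictAntiOn_deriv (hs : Convex ℝ s) (hg : ∀ t ∈ s, HasDerivAt g (g' t) t)
    (hg' : StrictAntiOn g' s) (hw : w ∈ s) (hw0 : g' w = 0) (ht : t ∈ s) (htw : t ≠ w) :
    g t < g w := by
  have continuousOn {u v : ℝ} (hu : u ∈ s) (hv : v ∈ s) : ContinuousOn g (Icc u v) := fun x hx ↦
    (hg x (hs.ordConnected.out hu hv hx)).continuousAt.continuousWithinAt
  rcases htw.lt_or_gt with hlt | hgt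
  · refine strictMonoOn_of_deriv_pos (convex_Icc t w) (continuousOn ht hw) (fun x hx ↦ ?_)
      (left_mem_Icc.2 hlt.le) (right_mem_Icc.2 hlt.le) hlt
    rw [interior_Icc] at hx
    have hxs := hs.ordConnected.out ht hw (Ioo_subset_Icc_self hx)
    rw [(hg x hxs).deriv, ← hw0]
    exact hg' hxs hw hx.2
  · refine strictAntiOn_of_deriv_neg (convex_Icc w t) (continuousOn hw ht) (fun x hx ↦ ?_)
      (left_mem_Icc.2 hgt.le) (right_mem_Icc.2 hgt.le) hgt
    rw [interior_Icc] at hx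
    have hxs := hs.ordConnected.out hw ht (Ioo_subset_Icc_self hx)
    rw [(hg x hxs).deriv, ← hw0]
    exact hg' hw hxs hx.1

end ConcaveFunctions

section UniformNeighborhoods

variable {Θ P : Type*} [TopologicalSpace Θ] [PseudoMetricSpace P] {K : Set Θ} {x : P}

theorem eventually_forall_mem_closedBall {p : P → Prop} (hp : ∀ᶠ y in 𝓝 x, p y) :
    ∀ᶠ η in 𝓝[>] (0 : ℝ), ∀ y ∈ closedBall x η, p y :=
  ((tendsto_closedBall_smallSets x).eventually (eventually_smallSets_forall.2 hp)).filter_mono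
    nhdsWithin_le_nhds

theorem eventually_forall_mem_rectangle (hK : IsCompact K) {t : ℝ} {p : (Θ × P) × ℝ → Prop}
    (hp : ∀ θ ∈ K, ∀ᶠ z in 𝓝 ((θ, x), t), p z) :
    ∀ᶠ ηω in 𝓝[>] (0 : ℝ), ∀ᶠ ημ in 𝓝[>] (0 : ℝ),
      ∀ z ∈ (K ×ˢ closedBall x ημ) ×ˢ closedBall t ηω, p z := by
  have hunif : ∀ᶠ v : P × ℝ in 𝓝 (x, t), ∀ θ ∈ K, p ((θ, v.1), v.2) := by
    refine hK.eventually_forall_of_forall_eventually fun θ hθ ↦ ?_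
    have hc : Tendsto (fun u : (P × ℝ) × Θ ↦ ((u.2, u.1.1), u.1.2)) (𝓝 ((x, t), θ))
        (𝓝 ((θ, x), t)) := Continuous.tendsto (by fun_prop) ((x, t), θ)
    exact hc.eventually (hp θ hθ)
  obtain ⟨ε, hε, hball⟩ := Metric.eventually_nhds_iff_ball.1 hunif
  rw [← ball_prod_same] at hball
  filter_upwards [Ioo_mem_nhdsGT hε] with ηω hω
  filter_upwards [Ioo_mem_nhdsGT hε] with ημ hμ
  rintro ⟨⟨θ, y⟩, s⟩ ⟨⟨hθ, hy⟩, hs⟩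
  exact hball (y, s) ⟨closedBall_subset_ball hμ.2 hy, closedBall_subset_ball hω.2 hs⟩ θ hθ

theorem eventually_forall_abs_sub_lt (hK : IsCompact K) {g : Θ × P → ℝ}
    (hg : ∀ θ ∈ K, ContinuousAt g (θ, x)) {ε : ℝ} (hε : 0 < ε) :
    ∀ᶠ v : P × P in 𝓝 (x, x), ∀ θ ∈ K, |g (θ, v.1) - g (θ, v.2)| < ε := by
  refine hK.eventually_forall_of_forall_eventually fun θ hθ ↦ ?_
  have h₁ : ContinuousAt (fun u : (P × P) × Θ ↦ g (u.2, u.1.1)) ((x, x), θ) :=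
    ContinuousAt.comp' (hg θ hθ) (by fun_prop)
  have h₂ : ContinuousAt (fun u : (P × P) × Θ ↦ g (u.2, u.1.2)) ((x, x), θ) :=
    ContinuousAt.comp' (hg θ hθ) (by fun_prop)
  exact (h₁.sub h₂).abs.eventually_lt_const (by simpa using hε)

theorem exists_pos_forall_mem_of_forall_eventually {X : Type*} [TopologicalSpace X] {Z : Set X}
    (hZ : IsCompact Z) {B : ℝ → X → Prop} (hmono : ∀ z, Monotone (B · z))
    (hB : ∀ z ∈ Z, ∃ γ, ∀ᶠ y in 𝓝 z, B γ y) : ∃ γ > 0, ∀ z ∈ Z, B γ z := by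
  have hev : ∀ᶠ q in atTop ×ˢ 𝓝ˢ Z, B q.1 q.2 := by
    refine hZ.mem_prod_nhdsSet_of_forall fun z hz ↦ ?_
    obtain ⟨γ, hγ⟩ := hB z hz
    exact ((eventually_ge_atTop γ).prod_mk hγ).mono fun q hq ↦ hmono q.2 hq.1 hq.2
  obtain ⟨γ, hγ, hγ0⟩ := (hev.curry.and (eventually_gt_atTop 0)).exists
  exact ⟨γ, hγ0, hγ.self_of_nhdsSet⟩

end UniformNeighborhoods

section IteratedPartialDerivatives

variable {d : ℕ}

theorem contDiffAt_lineDeriv {X : Type*} [NormedAddCommGroup X] [NormedSpace ℝ X] {k : ℕ}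
    {G : X → ℝ} {x : X} (v : X) (hG : ContDiffAt ℝ (k + 1 : ℕ) G x) :
    ContDiffAt ℝ k (fun y ↦ lineDeriv ℝ G y v) x := by
  have hG' : ContDiffAt ℝ k (fun y ↦ fderiv ℝ G y v) x :=
    (hG.fderiv_right (m := k) (by simp)).clm_apply contDiffAt_const
  refine hG'.congr_of_eventuallyEq ?_
  filter_upwards [hG.eventually (by simp)] with y hy
  exact (hy.differentiableAt (by simp)).lineDeriv_eq_fderiv

/-- The iterated partial derivative `∂_{q₁} ∂_{q₂} ⋯ f` for a list `[q₁, q₂, …]` of coordinates. -/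
noncomputable def iteratedPartialD (L : List (Fin d)) (f : Par d → ℝ) : Par d → ℝ :=
  L.foldr partialD f

theorem iteratedPartialD_congr {f g : Par d → ℝ} {μ : Par d} (hfg : f =ᶠ[𝓝 μ] g)
    (L : List (Fin d)) : iteratedPartialD L f =ᶠ[𝓝 μ] iteratedPartialD L g := by
  induction L with
  | nil => exact hfg
  | cons q L ih => exact ih.eventuallyEq_nhds.mono fun ν hν ↦ hν.lineDeriv_eq

theorem contDiffAt_iteratedPartialD_slice {Θ : Type*} [NormedAddCommGroup Θ] [NormedSpace ℝ Θ]
    {G : Θ × Par d → ℝ} {x₀ : Θ × Par d} (L : List (Fin d)) {k : ℕ}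
    (hG : ContDiffAt ℝ (k + L.length : ℕ) G x₀) :
    ContDiffAt ℝ k (fun x ↦ iteratedPartialD L (fun ν ↦ G (x.1, ν)) x.2) x₀ := by
  induction L generalizing k with
  | nil => exact hG
  | cons q L ih =>
    have hL := contDiffAt_lineDeriv (0, EuclideanSpace.single q 1)
      (ih (k := k + 1) (by rwa [List.length_cons, ← add_assoc, add_right_comm] at hG))
    refine hL.congr_of_eventuallyEq (.of_forall fun x ↦ ?_)
    simp [iteratedPartialD, partialD, lineDeriv]

/-- All partial derivatives of `f` at `μ` of order at most `N` are bounded by `γ`. -/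
def PartialsBoundedBy (N : ℕ) (γ : ℝ) (f : Par d → ℝ) (μ : Par d) : Prop :=
  ∀ L : List (Fin d), L.length ≤ N → |iteratedPartialD L f μ| ≤ γ

theorem PartialsBoundedBy.congr {N : ℕ} {γ : ℝ} {f g : Par d → ℝ} {μ : Par d}
    (hf : PartialsBoundedBy N γ f μ) (hgf : g =ᶠ[𝓝 μ] f) : PartialsBoundedBy N γ g μ :=
  fun L hL ↦ (iteratedPartialD_congr hgf L).eq_of_nhds ▸ hf L hL

theorem PartialsBoundedBy.mono {N : ℕ} {γ γ' : ℝ} {f : Par d → ℝ} {μ : Par d}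
    (hf : PartialsBoundedBy N γ f μ) (hγ : γ ≤ γ') : PartialsBoundedBy N γ' f μ :=
  fun L hL ↦ (hf L hL).trans hγ

theorem PartialsBoundedBy.abs_partialD_le {γ : ℝ} {f : Par d → ℝ} {μ : Par d}
    (hf : PartialsBoundedBy 3 γ f μ) :
    (∀ q r, |partialD q (partialD r f) μ| ≤ γ) ∧
      ∀ q r l, |partialD q (partialD r (partialD l f)) μ| ≤ γ :=
  ⟨fun q r ↦ hf [q, r] (by simp), fun q r l ↦ hf [q, r, l] (by simp)⟩

theorem exists_eventually_partialsBoundedBy_slice {Θ : Type*} [NormedAddCommGroup Θ]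
    [NormedSpace ℝ Θ] {G : Θ × Par d → ℝ} {x₀ : Θ × Par d} {N : ℕ} (hG : ContDiffAt ℝ N G x₀) :
    ∃ γ, ∀ᶠ x in 𝓝 x₀, PartialsBoundedBy N γ (fun ν ↦ G (x.1, ν)) x.2 := by
  have hfin := List.finite_length_le (Fin d) N
  obtain ⟨γ, hγ⟩ := (hfin.image fun L ↦
    |iteratedPartialD L (fun ν ↦ G (x₀.1, ν)) x₀.2|).bddAbove
  refine ⟨γ + 1, hfin.eventually_all.2 fun L (hL : L.length ≤ N) ↦ ?_⟩
  have hcont := (contDiffAt_iteratedPartialD_slice L (k := 0) (x₀ := x₀)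
    (hG.of_le (by simpa using hL))).continuousAt.abs
  exact (hcont.eventually_lt_const ((hγ (mem_image_of_mem _ hL)).trans_lt (lt_add_one γ))).mono
    fun x hx ↦ hx.le

end IteratedPartialDerivatives

section UniformlyConcave

variable {X : Type*} [NormedAddCommGroup X] [NormedSpace ℝ X] {F : X × ℝ → ℝ} {c : ℝ}

/-- `F` is of class `C⁴` near `Z` and uniformly concave in the real variable, `∂²F/∂t² ≤ c`, on `Z`.
One of the four derivatives is lost in passing to `∂F/∂t`, whose zeros then form `C³` branches. -/
def UniformlyConcaveOn (F : X × ℝ → ℝ) (c : ℝ) (Z : Set (X × ℝ)) : Prop :=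
  ∀ z ∈ Z, ContDiffAt ℝ (4 : ℕ) F z ∧ derivSnd (derivSnd F) z ≤ c

namespace UniformlyConcaveOn

theorem hasDerivAt {Z : Set (X × ℝ)} (h : UniformlyConcaveOn F c Z) {z : X × ℝ} (hz : z ∈ Z) :
    HasDerivAt (fun t ↦ F (z.1, t)) (derivSnd F z) z.2 :=
  hasDerivAt_derivSnd ((h z hz).1.differentiableAt (by simp))

theorem hasDerivAt_derivSnd {Z : Set (X × ℝ)} (h : UniformlyConcaveOn F c Z) {z : X × ℝ}
    (hz : z ∈ Z) : HasDerivAt (fun t ↦ derivSnd F (z.1, t)) (derivSnd (derivSnd F) z) z.2 :=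
  _root_.hasDerivAt_derivSnd
    ((contDiffAt_derivSnd (k := 3) (h z hz).1).differentiableAt (by simp))

variable {A : Set X} {J : Set ℝ} {x : X}

theorem derivSnd_sub_le (h : UniformlyConcaveOn F c (A ×ˢ J)) (hJ : Convex ℝ J) (hx : x ∈ A)
    {s t : ℝ} (hs : s ∈ J) (ht : t ∈ J) (hst : s ≤ t) :
    derivSnd F (x, t) - derivSnd F (x, s) ≤ c * (t - s) := by
  have hd : ∀ u ∈ J, HasDerivAt (fun t ↦ derivSnd F (x, t)) (derivSnd (derivSnd F) (x, u)) u :=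
    fun u hu ↦ h.hasDerivAt_derivSnd (z := (x, u)) ⟨hx, hu⟩
  refine hJ.image_sub_le_mul_sub_of_deriv_le
    (fun u hu ↦ (hd u hu).continuousAt.continuousWithinAt)
    (fun u hu ↦ (hd u (interior_subset hu)).differentiableAt.differentiableWithinAt)
    (fun u hu ↦ ?_) s hs t ht hst
  rw [(hd u (interior_subset hu)).deriv]
  exact (h (x, u) ⟨hx, interior_subset hu⟩).2

theorem strictAntiOn (h : UniformlyConcaveOn F c (A ×ˢ J)) (hJ : Convex ℝ J) (hc : c < 0)
    (hx : x ∈ A) : StrictAntiOn (fun t ↦ derivSnd F (x, t)) J := fun _ hs _ ht hst ↦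
  sub_neg.1 ((h.derivSnd_sub_le hJ hx hs ht hst.le).trans_lt
    (mul_neg_of_neg_of_pos hc (sub_pos.2 hst)))

theorem lt_of_derivSnd_eq_zero (h : UniformlyConcaveOn F c (A ×ˢ J)) (hJ : Convex ℝ J) (hc : c < 0)
    (hx : x ∈ A) {w t : ℝ} (hw : w ∈ J) (hw0 : derivSnd F (x, w) = 0) (ht : t ∈ J) (htw : t ≠ w) :
    F (x, t) < F (x, w) :=
  lt_of_strictAntiOn_deriv (g := fun t ↦ F (x, t)) hJ
    (fun u hu ↦ h.hasDerivAt (z := (x, u)) ⟨hx, hu⟩) (h.strictAntiOn hJ hc hx) hw hw0 ht htw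

variable {t η : ℝ}

theorem exists_derivSnd_eq_zero (h : UniformlyConcaveOn F c (A ×ˢ closedBall t η)) (hc : c < 0)
    (hη : 0 < η) {x₀ : X} (hx₀ : x₀ ∈ A) {s : ℝ} (hs : s ∈ closedBall t (η / 2))
    (hs0 : derivSnd F (x₀, s) = 0) (hx : x ∈ A)
    (hleft : |derivSnd F (x₀, t - η) - derivSnd F (x, t - η)| < -c * (η / 2))
    (hright : |derivSnd F (x₀, t + η) - derivSnd F (x, t + η)| < -c * (η / 2)) :
    ∃ w ∈ ball t η, derivSnd F (x, w) = 0 := by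
  rw [Real.closedBall_eq_Icc] at h hs
  have hJ : Convex ℝ (Icc (t - η) (t + η)) := convex_Icc _ _
  have hs' : s ∈ Icc (t - η) (t + η) := ⟨by linarith [hs.1], by linarith [hs.2]⟩
  have hl : t - η ∈ Icc (t - η) (t + η) := ⟨le_rfl, by linarith⟩
  have hr : t + η ∈ Icc (t - η) (t + η) := ⟨by linarith, le_rfl⟩
  have hpos : 0 < derivSnd F (x, t - η) := by
    have := h.derivSnd_sub_le hJ hx₀ hl hs' hs'.1
    nlinarith [hs.1, (abs_lt.1 hleft).2]
  have hneg : derivSnd F (x, t + η) < 0 := by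
    have := h.derivSnd_sub_le hJ hx₀ hs' hr hs'.2
    nlinarith [hs.2, (abs_lt.1 hright).1]
  have hcont : ContinuousOn (fun u ↦ derivSnd F (x, u)) (Icc (t - η) (t + η)) := fun u hu ↦
    (h.hasDerivAt_derivSnd (z := (x, u)) ⟨hx, hu⟩).continuousAt.continuousWithinAt
  obtain ⟨w, hw, hw0⟩ := intermediate_value_Ioo' (by linarith) hcont ⟨hneg, hpos⟩
  exact ⟨w, by rwa [Real.ball_eq_Ioo], hw0⟩

theorem contDiffOn_of_derivSnd_eq_zero [CompleteSpace X]
    (h : UniformlyConcaveOn F c (A ×ˢ closedBall t η)) (hc : c < 0) {w : X → ℝ}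
    (hw : ∀ x ∈ A, w x ∈ ball t η) (hw0 : ∀ x ∈ A, derivSnd F (x, w x) = 0) :
    ContDiffOn ℝ 3 w A := by
  intro x hx
  obtain ⟨hF, hle⟩ := h (x, w x) ⟨hx, ball_subset_closedBall (hw x hx)⟩
  obtain ⟨ψ, hψx : ψ x = w x, hψ, hiff⟩ := exists_contDiffAt_implicitFunction (n := (3 : ℕ))
    (by simp) (contDiffAt_derivSnd hF) (hle.trans_lt hc).ne
  have hgraph : Tendsto (fun y ↦ (y, ψ y)) (𝓝 x) (𝓝 (x, w x)) :=
    tendsto_id.prodMk_nhds (hψx ▸ hψ.continuousAt)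
  have hψball : ∀ᶠ y in 𝓝 x, ψ y ∈ ball t η :=
    hψ.continuousAt.eventually_mem (isOpen_ball.mem_nhds (hψx ▸ hw x hx))
  have heq : w =ᶠ[𝓝[A] x] ψ := by
    filter_upwards [nhdsWithin_le_nhds (hgraph.eventually hiff), nhdsWithin_le_nhds hψball,
      self_mem_nhdsWithin] with y hy hyball hyA
    have hψ0 : derivSnd F (y, ψ y) = 0 := (hy.2 rfl).trans (hw0 x hx)
    exact (h.strictAntiOn (convex_closedBall t η) hc hyA).injOn
      (ball_subset_closedBall (hw y hyA)) (ball_subset_closedBall hyball)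
      ((hw0 y hyA).trans hψ0.symm)
  exact hψ.contDiffWithinAt.congr_of_eventuallyEq_of_mem heq hx

end UniformlyConcaveOn

variable {Θ P : Type*} [NormedAddCommGroup Θ] [NormedSpace ℝ Θ] [NormedAddCommGroup P]
  [NormedSpace ℝ P] {G : (Θ × P) × ℝ → ℝ} {K : Set Θ} {x : P} {t c' : ℝ}

theorem eventually_uniformlyConcaveOn (hK : IsCompact K)
    (hG : ∀ θ ∈ K, ContDiffAt ℝ (4 : ℕ) G ((θ, x), t))
    (hc : ∀ θ ∈ K, derivSnd (derivSnd G) ((θ, x), t) ≤ c) (hcc' : c < c') :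
    ∀ᶠ ηω in 𝓝[>] (0 : ℝ), ∀ᶠ ημ in 𝓝[>] (0 : ℝ),
      UniformlyConcaveOn G c' ((K ×ˢ closedBall x ημ) ×ˢ closedBall t ηω) := by
  refine eventually_forall_mem_rectangle hK fun θ hθ ↦ ?_
  have hcont : ContinuousAt (derivSnd (derivSnd G)) ((θ, x), t) :=
    (contDiffAt_derivSnd (k := 2) (contDiffAt_derivSnd (hG θ hθ))).continuousAt
  exact ((hG θ hθ).eventually (by simp)).and
    ((hcont.eventually_lt_const ((hc θ hθ).trans_lt hcc')).mono fun _ ↦ le_of_lt)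

theorem UniformlyConcaveOn.eventually_exists_derivSnd_eq_zero (hK : IsCompact K) (hc : c < 0)
    {ηω : ℝ} (hηω : 0 < ηω)
    (h : ∀ᶠ ημ in 𝓝[>] (0 : ℝ),
      UniformlyConcaveOn G c ((K ×ˢ closedBall x ημ) ×ˢ closedBall t ηω)) :
    ∀ᶠ ημ in 𝓝[>] (0 : ℝ), ∀ θ ∈ K, ∀ y₀ ∈ closedBall x ημ, ∀ s ∈ closedBall t (ηω / 2),
      derivSnd G ((θ, y₀), s) = 0 →
        ∀ y ∈ closedBall x ημ, ∃ w ∈ ball t ηω, derivSnd G ((θ, y), w) = 0 := by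
  have hcont : ∀ u ∈ closedBall t ηω, ∀ θ ∈ K,
      ContinuousAt (fun v ↦ derivSnd G (v, u)) (θ, x) := by
    intro u hu θ hθ
    obtain ⟨ημ, hημ, hpos : 0 < ημ⟩ := (h.and self_mem_nhdsWithin).exists
    have hG := (hημ ((θ, x), u) ⟨⟨hθ, mem_closedBall_self hpos.le⟩, hu⟩).1
    exact (contDiffAt_derivSnd (k := 3) hG).continuousAt.comp (f := fun v ↦ (v, u)) (by fun_prop)
  have hmargin : 0 < -c * (ηω / 2) := by nlinarith
  have hosc (u : ℝ) (hu : u ∈ closedBall t ηω) :=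
    eventually_forall_mem_closedBall (eventually_forall_abs_sub_lt hK (hcont u hu) hmargin)
  have hleft : t - ηω ∈ closedBall t ηω := by simp [abs_of_pos hηω]
  have hright : t + ηω ∈ closedBall t ηω := by simp [abs_of_pos hηω]
  filter_upwards [h, hosc _ hleft, hosc _ hright] with ημ hημ hl hr θ hθ y₀ hy₀ s hs hs0 y hy
  have hpair : (y₀, y) ∈ closedBall (x, x) ημ := closedBall_prod_same x x ημ ▸ ⟨hy₀, hy⟩
  exact hημ.exists_derivSnd_eq_zero hc hηω ⟨hθ, hy₀⟩ hs hs0 ⟨hθ, hy⟩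
    (hl _ hpair θ hθ) (hr _ hpair θ hθ)

end UniformlyConcave

section Branches

variable {d : ℕ} {μs : Par d} {ωs ημ ηω c : ℝ}

theorem UniformlyConcaveOn.exists_isCritBranch {g : Par d → ℝ → ℝ}
    (h : UniformlyConcaveOn g.uncurry c (closedBall μs ημ ×ˢ closedBall ωs ηω)) (hc : c < 0)
    (hex : ∀ μ ∈ closedBall μs ημ, ∃ ω ∈ ball ωs ηω, derivSnd g.uncurry (μ, ω) = 0)
    {μ₀ : Par d} {ω₀ : ℝ} (hμ₀ : μ₀ ∈ closedBall μs ημ) (hω₀ : ω₀ ∈ closedBall ωs ηω)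
    (h₀ : derivSnd g.uncurry (μ₀, ω₀) = 0) :
    ∃ w, IsCritBranch g μs ωs ημ ηω μ₀ ω₀ w ∧ ContDiffOn ℝ 3 w (closedBall μs ημ) := by
  choose! w hw hw0 using hex
  have hw' (μ) (hμ : μ ∈ closedBall μs ημ) : w μ ∈ closedBall ωs ηω :=
    ball_subset_closedBall (hw μ hμ)
  have hsmooth := h.contDiffOn_of_derivSnd_eq_zero hc hw hw0
  refine ⟨w, ⟨hsmooth.continuousOn, hw', hμ₀, ?_, fun μ hμ ↦ ?_⟩, hsmooth⟩
  · exact (h.strictAntiOn (convex_closedBall ωs ηω) hc hμ₀).injOn (hw' μ₀ hμ₀) hω₀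
      ((hw0 μ₀ hμ₀).trans h₀.symm)
  · exact hw0 μ hμ ▸ h.hasDerivAt (z := (μ, w μ)) ⟨hμ, hw' μ hμ⟩

namespace IsCritBranch

variable {g : Par d → ℝ → ℝ} {μ₀ : Par d} {ω₀ : ℝ} {w w' : Par d → ℝ}

theorem eq_of_hasDerivAt_zero (hw : IsCritBranch g μs ωs ημ ηω μ₀ ω₀ w)
    (h : UniformlyConcaveOn g.uncurry c (closedBall μs ημ ×ˢ closedBall ωs ηω)) (hc : c < 0)
    {μ : Par d} (hμ : μ ∈ closedBall μs ημ) {ω : ℝ} (hω : ω ∈ closedBall ωs ηω)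
    (hd : HasDerivAt (g μ) 0 ω) : ω = w μ :=
  (h.strictAntiOn (convex_closedBall ωs ηω) hc hμ).injOn hω (hw.maps hμ)
    (hd.deriv.trans (hw.crit μ hμ).deriv.symm)

theorem eqOn (hw : IsCritBranch g μs ωs ημ ηω μ₀ ω₀ w)
    (h : UniformlyConcaveOn g.uncurry c (closedBall μs ημ ×ˢ closedBall ωs ηω)) (hc : c < 0)
    (hw' : IsCritBranch g μs ωs ημ ηω μ₀ ω₀ w') : EqOn w' w (closedBall μs ημ) :=
  fun μ hμ ↦ hw.eq_of_hasDerivAt_zero h hc hμ (hw'.maps hμ) (hw'.crit μ hμ)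

theorem lt_of_ne (hw : IsCritBranch g μs ωs ημ ηω μ₀ ω₀ w)
    (h : UniformlyConcaveOn g.uncurry c (closedBall μs ημ ×ˢ closedBall ωs ηω)) (hc : c < 0)
    {μ : Par d} (hμ : μ ∈ closedBall μs ημ) {ω : ℝ} (hω : ω ∈ closedBall ωs ηω) (hne : ω ≠ w μ) :
    g μ ω < g μ (w μ) :=
  h.lt_of_derivSnd_eq_zero (convex_closedBall ωs ηω) hc hμ (hw.maps hμ) (hw.crit μ hμ).deriv hω hne

theorem iteratedDeriv_two_le (hw : IsCritBranch g μs ωs ημ ηω μ₀ ω₀ w)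
    (h : UniformlyConcaveOn g.uncurry c (closedBall μs ημ ×ˢ closedBall ωs ηω))
    {μ : Par d} (hμ : μ ∈ closedBall μs ημ) : iteratedDeriv 2 (g μ) (w μ) ≤ c := by
  rw [iteratedDeriv_succ, iteratedDeriv_one]
  exact (h (μ, w μ) ⟨hμ, hw.maps hμ⟩).2

theorem contDiffOn_value (hw : IsCritBranch g μs ωs ημ ηω μ₀ ω₀ w)
    (h : UniformlyConcaveOn g.uncurry c (closedBall μs ημ ×ˢ closedBall ωs ηω))
    (hsmooth : ContDiffOn ℝ 3 w (closedBall μs ημ)) :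
    ContDiffOn ℝ 3 (fun μ ↦ g μ (w μ)) (closedBall μs ημ) := fun μ hμ ↦
  ((h (μ, w μ) ⟨hμ, hw.maps hμ⟩).1.of_le (by norm_cast)).comp_contDiffWithinAt
    (f := fun μ ↦ (μ, w μ)) μ (contDiffWithinAt_id.prodMk (hsmooth μ hμ))

end IsCritBranch

variable {Θ : Type*} [NormedAddCommGroup Θ] [NormedSpace ℝ Θ] {F : (Θ × Par d) × ℝ → ℝ}
  {K : Set Θ}

theorem UniformlyConcaveOn.slice
    (h : UniformlyConcaveOn F c ((K ×ˢ closedBall μs ημ) ×ˢ closedBall ωs ηω)) {θ : Θ}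
    (hθ : θ ∈ K) : UniformlyConcaveOn (fun z : Par d × ℝ ↦ F ((θ, z.1), z.2)) c
      (closedBall μs ημ ×ˢ closedBall ωs ηω) := fun z hz ↦
  have hF := h ((θ, z.1), z.2) ⟨⟨hθ, hz.1⟩, hz.2⟩
  ⟨hF.1.comp (f := fun z : Par d × ℝ ↦ ((θ, z.1), z.2)) z (by fun_prop), hF.2⟩

/-- Whenever `w` is a continuous branch through `z = ((θ, μ), w μ)` of critical points of
`F ((θ, ·), ·)` in the real variable, the partial derivatives at `μ` of order at most three of the
critical value are bounded by `γ`. -/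
def CritValuePartialsBoundedBy (F : (Θ × Par d) × ℝ → ℝ) (γ : ℝ) (z : (Θ × Par d) × ℝ) : Prop :=
  ∀ w : Par d → ℝ, ContinuousAt w z.1.2 → w z.1.2 = z.2 →
    (∀ᶠ ν in 𝓝 z.1.2, derivSnd F ((z.1.1, ν), w ν) = 0) →
      PartialsBoundedBy 3 γ (fun ν ↦ F ((z.1.1, ν), w ν)) z.1.2

variable [CompleteSpace Θ]

theorem exists_eventually_critValuePartialsBoundedBy {z₀ : (Θ × Par d) × ℝ}
    (hF : ContDiffAt ℝ (4 : ℕ) F z₀) (h₀ : derivSnd F z₀ = 0)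
    (h₂ : derivSnd (derivSnd F) z₀ ≠ 0) :
    ∃ γ, ∀ᶠ z in 𝓝 z₀, CritValuePartialsBoundedBy F γ z := by
  obtain ⟨ψ, hψ₀, hψ, hiff⟩ :=
    exists_contDiffAt_implicitFunction (n := (3 : ℕ)) (by simp) (contDiffAt_derivSnd hF) h₂
  have hvalue : ContDiffAt ℝ (3 : ℕ) (fun x ↦ F (x, ψ x)) z₀.1 := by
    refine ContDiffAt.comp (g := F) (f := fun x ↦ (x, ψ x)) z₀.1 ?_ (contDiffAt_id.prodMk hψ)
    rw [hψ₀]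
    exact hF.of_le (by norm_cast)
  obtain ⟨γ, hγ⟩ := exists_eventually_partialsBoundedBy_slice hvalue
  refine ⟨γ, ?_⟩
  filter_upwards [continuousAt_fst.eventually hγ, hiff.eventually_nhds]
  rintro ⟨⟨θ, μ⟩, ω⟩ hbound hψ_iff w hcont hw hcrit
  simp only at hbound hψ_iff hcont hw hcrit
  have hgraph : Tendsto (fun ν ↦ ((θ, ν), w ν)) (𝓝 μ) (𝓝 ((θ, μ), ω)) :=
    (tendsto_const_nhds.prodMk_nhds tendsto_id).prodMk_nhds (hw ▸ hcont)
  refine hbound.congr ?_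
  filter_upwards [hgraph.eventually hψ_iff, hcrit] with ν hν hν0
  rw [hν.1 (hν0.trans h₀.symm)]

theorem UniformlyConcaveOn.exists_partialsBoundedBy_critValue (hK : IsCompact K) (hc : c < 0)
    (h : UniformlyConcaveOn F c ((K ×ˢ closedBall μs ημ) ×ˢ closedBall ωs ηω)) {η' : ℝ}
    (hη' : η' < ημ) :
    ∃ γ > 0, ∀ θ ∈ K, ∀ μ₀ ω₀ w,
      IsCritBranch (fun μ ω ↦ F ((θ, μ), ω)) μs ωs ημ ηω μ₀ ω₀ w →
        ∀ μ ∈ closedBall μs η', PartialsBoundedBy 3 γ (fun ν ↦ F ((θ, ν), w ν)) μ := by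
  have hsub : closedBall μs η' ⊆ closedBall μs ημ := closedBall_subset_closedBall hη'.le
  have hR {z} (hz : z ∈ (K ×ˢ closedBall μs η') ×ˢ closedBall ωs ηω) :=
    h z ⟨⟨hz.1.1, hsub hz.1.2⟩, hz.2⟩
  have hZ : IsCompact (((K ×ˢ closedBall μs η') ×ˢ closedBall ωs ηω) ∩ derivSnd F ⁻¹' {0}) := by
    have hrect : IsCompact ((K ×ˢ closedBall μs η') ×ˢ closedBall ωs ηω) :=
      (hK.prod (isCompact_closedBall _ _)).prod (isCompact_closedBall _ _)
    have hcont : ContinuousOn (derivSnd F) ((K ×ˢ closedBall μs η') ×ˢ closedBall ωs ηω) :=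
      fun z hz ↦ (contDiffAt_derivSnd (k := 3) (hR hz).1).continuousAt.continuousWithinAt
    exact hrect.of_isClosed_subset
      (hcont.preimage_isClosed_of_isClosed hrect.isClosed isClosed_singleton) inter_subset_left
  obtain ⟨γ, hγ, hbound⟩ := exists_pos_forall_mem_of_forall_eventually hZ
    (B := CritValuePartialsBoundedBy F)
    (fun z γ γ' hγ hz w hwc hw hcrit ↦ (hz w hwc hw hcrit).mono hγ)
    fun z hz ↦ exists_eventually_critValuePartialsBoundedBy (hR hz.1).1 hz.2
      ((hR hz.1).2.trans_lt hc).ne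
  refine ⟨γ, hγ, fun θ hθ μ₀ ω₀ w hw μ hμ ↦ ?_⟩
  have hnhds : closedBall μs ημ ∈ 𝓝 μ :=
    closedBall_mem_nhds_of_mem (mem_ball.2 ((mem_closedBall.1 hμ).trans_lt hη'))
  exact hbound ((θ, μ), w μ)
    ⟨⟨⟨hθ, hμ⟩, hw.maps (hsub hμ)⟩, (hw.crit μ (hsub hμ)).deriv⟩ w (hw.cont.continuousAt hnhds) rfl
    (eventually_of_mem hnhds fun ν hν ↦ (hw.crit ν hν).deriv)

end Branches

/-! ### Hermite interpolation -/

section HermiteInterpolation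

open scoped Matrix.Norms.L2Operator
open Asymptotics

theorem exists_mul_eq_of_colSpace_le {a b c : ℕ} {M : Matrix (Fin a) (Fin b) ℂ}
    {V : Matrix (Fin a) (Fin c) ℂ} (h : colSpace M ≤ colSpace V) :
    ∃ Y : Matrix (Fin c) (Fin b) ℂ, V * Y = M := by
  have hcol : ∀ j, ∃ y, V *ᵥ y = M.col j := fun j ↦ h ⟨Pi.single j 1, by simp⟩
  choose y hy using hcol
  refine ⟨Matrix.of fun i j ↦ y j i, ?_⟩
  ext i j
  exact congrFun (hy j) i

variable {n m p r : ℕ}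

theorem conjTranspose_mul_self_sub_isLittleO {R : ℝ → Matrix (Fin p) (Fin m) ℂ}
    (hR : DifferentiableAt ℝ R 0) :
    (fun t ↦ (R t - R 0)ᴴ * (R t - R 0)) =o[𝓝 0] fun t : ℝ ↦ t := by
  have hlin : (fun t ↦ R t - R 0) =O[𝓝 0] fun t : ℝ ↦ t := by simpa using hR.isBigO_sub
  have hsmall : (fun t ↦ R t - R 0) =o[𝓝 0] fun _ : ℝ ↦ (1 : ℝ) :=
    hlin.trans_isLittleO ((isLittleO_one_iff ℝ).2 tendsto_id)
  have hmul := hlin.norm_left.mul_isLittleO hsmall.norm_left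
  simp only [mul_one] at hmul
  refine (IsBigO.of_bound 1 (Eventually.of_forall fun t ↦ ?_)).trans_isLittleO hmul
  rw [Matrix.l2_opNorm_conjTranspose_mul_self, one_mul]
  exact le_abs_self _

/- With `P₀ = P 0 = Q 0`, one has `QᴴQ - PᴴP = P₀ᴴ(Q - P) + (Q - P)ᴴP₀ + (Q - P₀)ᴴ(Q - P₀)
- (P - P₀)ᴴ(P - P₀)`. -/
theorem norm_sq_sub_norm_sq_isLittleO {P Q : ℝ → Matrix (Fin p) (Fin m) ℂ}
    (hP : DifferentiableAt ℝ P 0) (hQ : DifferentiableAt ℝ Q 0) (h0 : Q 0 = P 0)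
    (h : (fun t ↦ (P 0)ᴴ * (Q t - P t)) =o[𝓝 0] fun t : ℝ ↦ t) :
    (fun t ↦ ‖Q t‖ ^ 2 - ‖P t‖ ^ 2) =o[𝓝 0] fun t : ℝ ↦ t := by
  have hadj : (fun t ↦ (Q t - P t)ᴴ * P 0) =o[𝓝 0] fun t : ℝ ↦ t := by
    refine (h.norm_left.congr_left fun t ↦ ?_).of_norm_left
    rw [← Matrix.l2_opNorm_conjTranspose, Matrix.conjTranspose_mul,
      Matrix.conjTranspose_conjTranspose]
  have hgram : (fun t ↦ (Q t)ᴴ * Q t - (P t)ᴴ * P t) =o[𝓝 0] fun t : ℝ ↦ t := by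
    refine (((h.add hadj).add (conjTranspose_mul_self_sub_isLittleO hQ)).sub
      (conjTranspose_mul_self_sub_isLittleO hP)).congr_left fun t ↦ ?_
    rw [h0]
    simp only [Matrix.conjTranspose_sub, Matrix.sub_mul, Matrix.mul_sub]
    abel
  refine (IsBigO.of_bound 1 (Eventually.of_forall fun t ↦ ?_)).trans_isLittleO hgram
  rw [sq, sq, ← Matrix.l2_opNorm_conjTranspose_mul_self, ← Matrix.l2_opNorm_conjTranspose_mul_self,
    one_mul]
  exact abs_norm_sub_norm_le _ _

/-- The transfer function of the pencil `D + t G`. Along the imaginary axis the transfer functions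
of a system and of its reduced systems have this form, with `t` the frequency shift. -/
noncomputable def pencilTf (C : Matrix (Fin p) (Fin n) ℂ) (D G : Matrix (Fin n) (Fin n) ℂ)
    (B : Matrix (Fin n) (Fin m) ℂ) (t : ℝ) : Matrix (Fin p) (Fin m) ℂ :=
  C * (D + (t : ℂ) • G)⁻¹ * B

variable {C : Matrix (Fin p) (Fin n) ℂ} {D G : Matrix (Fin n) (Fin n) ℂ}
  {B : Matrix (Fin n) (Fin m) ℂ} {V W : Matrix (Fin n) (Fin r) ℂ}

theorem pencilTf_zero : pencilTf C D G B 0 = C * D⁻¹ * B := by simp [pencilTf]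

theorem contDiffAt_pencil (D G : Matrix (Fin n) (Fin n) ℂ) :
    ContDiffAt ℝ 1 (fun t : ℝ ↦ D + (t : ℂ) • G) 0 :=
  contDiffAt_const.add (Complex.ofRealCLM.contDiff.contDiffAt.smul contDiffAt_const)

theorem differentiableAt_pencilTf (hD : D.det ≠ 0) : DifferentiableAt ℝ (pencilTf C D G B) 0 := by
  have hinv := contDiffAt_matrix_inv (contDiffAt_pencil D G) (by simpa using hD)
  exact (contDiffAt_matrix_mul (contDiffAt_matrix_mul contDiffAt_const hinv)
    contDiffAt_const).differentiableAt one_ne_zero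

theorem eventually_det_pencil_ne_zero (hD : D.det ≠ 0) :
    ∀ᶠ t : ℝ in 𝓝 0, (D + (t : ℂ) • G).det ≠ 0 :=
  (contDiffAt_matrix_det (contDiffAt_pencil D G)).continuousAt.eventually_ne
    (by simpa using hD)

theorem pencilTf_conjTranspose (t : ℝ) : (pencilTf C D G B t)ᴴ = pencilTf Bᴴ Dᴴ Gᴴ Cᴴ t := by
  simp [pencilTf, Matrix.conjTranspose_mul, Matrix.conjTranspose_nonsing_inv, Matrix.mul_assoc]

theorem reduced_pencilTf_conjTranspose (t : ℝ) :
    (pencilTf (C * V) (Wᴴ * D * V) (Wᴴ * G * V) (Wᴴ * B) t)ᴴ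
      = pencilTf (Bᴴ * W) (Vᴴ * Dᴴ * W) (Vᴴ * Gᴴ * W) (Vᴴ * Cᴴ) t := by
  simp only [pencilTf_conjTranspose, Matrix.conjTranspose_mul, Matrix.conjTranspose_conjTranspose,
    Matrix.mul_assoc]

theorem det_conjTranspose_ne_zero (hD : D.det ≠ 0) : Dᴴ.det ≠ 0 := by
  rw [Matrix.det_conjTranspose]; exact star_ne_zero.2 hD

theorem mul_pencilTf_eq_sub {q : ℕ} {X : Matrix (Fin q) (Fin p) ℂ} {L : Matrix (Fin q) (Fin n) ℂ}
    {t : ℝ} (hL : L * D = X * C) (ht : (D + (t : ℂ) • G).det ≠ 0) :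
    X * pencilTf C D G B t = L * B - (t : ℂ) • pencilTf (L * G) D G B t := by
  have hXC : X * C = L * (D + (t : ℂ) • G) - (t : ℂ) • (L * G) := by
    rw [Matrix.mul_add, Matrix.mul_smul, hL, add_sub_cancel_right]
  have hcancel : L * (D + (t : ℂ) • G) * (D + (t : ℂ) • G)⁻¹ = L :=
    Matrix.mul_nonsing_inv_cancel_right _ L ht.isUnit
  rw [pencilTf, pencilTf, ← Matrix.mul_assoc, ← Matrix.mul_assoc, hXC, Matrix.sub_mul,
    Matrix.sub_mul, hcancel, Matrix.smul_mul, Matrix.smul_mul]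

theorem reduced_pencilTf_zero (hD : D.det ≠ 0) (hDr : (Wᴴ * D * V).det ≠ 0)
    (hV : ∃ Y : Matrix (Fin r) (Fin m) ℂ, V * Y = D⁻¹ * B) :
    pencilTf (C * V) (Wᴴ * D * V) (Wᴴ * G * V) (Wᴴ * B) 0 = pencilTf C D G B 0 := by
  obtain ⟨Y, hY⟩ := hV
  have hB : Wᴴ * B = Wᴴ * D * V * Y := by
    rw [Matrix.mul_assoc, hY, Matrix.mul_assoc, Matrix.mul_nonsing_inv_cancel_left _ _ hD.isUnit]
  have hred : (Wᴴ * D * V)⁻¹ * (Wᴴ * B) = Y := by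
    rw [hB, Matrix.nonsing_inv_mul_cancel_left _ _ hDr.isUnit]
  rw [pencilTf_zero, pencilTf_zero, Matrix.mul_assoc, hred, Matrix.mul_assoc, hY, Matrix.mul_assoc]

theorem conjTranspose_mul_reduced_pencilTf_sub_isLittleO (hD : D.det ≠ 0)
    (hDr : (Wᴴ * D * V).det ≠ 0) (hV : ∃ Y : Matrix (Fin r) (Fin m) ℂ, V * Y = D⁻¹ * B)
    {X : Matrix (Fin p) (Fin m) ℂ} (hW : ∃ Z : Matrix (Fin r) (Fin m) ℂ, W * Z = Dᴴ⁻¹ * Cᴴ * X) :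
    (fun t ↦ Xᴴ * (pencilTf (C * V) (Wᴴ * D * V) (Wᴴ * G * V) (Wᴴ * B) t - pencilTf C D G B t))
      =o[𝓝 0] fun t : ℝ ↦ t := by
  obtain ⟨Z, hZ⟩ := hW
  have hL : (W * Z)ᴴ * D = Xᴴ * C := by
    rw [← Matrix.conjTranspose_inj, Matrix.conjTranspose_mul, Matrix.conjTranspose_conjTranspose,
      hZ, Matrix.mul_assoc,
      Matrix.mul_nonsing_inv_cancel_left _ _ (det_conjTranspose_ne_zero hD).isUnit,
      Matrix.conjTranspose_mul, Matrix.conjTranspose_conjTranspose]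
  have hLr : Zᴴ * (Wᴴ * D * V) = Xᴴ * (C * V) := by
    rw [← Matrix.mul_assoc Xᴴ, ← hL]
    simp only [Matrix.conjTranspose_mul, Matrix.mul_assoc]
  have hGr : Zᴴ * (Wᴴ * G * V) = (W * Z)ᴴ * G * V := by
    simp only [Matrix.conjTranspose_mul, Matrix.mul_assoc]
  have hBr : Zᴴ * (Wᴴ * B) = (W * Z)ᴴ * B := by
    simp only [Matrix.conjTranspose_mul, Matrix.mul_assoc]
  let R : ℝ → Matrix (Fin m) (Fin m) ℂ := fun t ↦ pencilTf ((W * Z)ᴴ * G) D G B t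
    - pencilTf ((W * Z)ᴴ * G * V) (Wᴴ * D * V) (Wᴴ * G * V) (Wᴴ * B) t
  have hR : Tendsto R (𝓝 0) (𝓝 0) := by
    have hcont : ContinuousAt R 0 := (differentiableAt_pencilTf hD).continuousAt.sub
      (differentiableAt_pencilTf hDr).continuousAt
    have hR0 : R 0 = 0 := sub_eq_zero.2 (reduced_pencilTf_zero hD hDr hV).symm
    simpa only [hR0] using hcont.tendsto
  have hsmul : (fun t : ℝ ↦ t • R t) =o[𝓝 0] fun t : ℝ ↦ t := by
    simpa using (isBigO_refl (fun t : ℝ ↦ t) (𝓝 0)).smul_isLittleO ((isLittleO_one_iff ℝ).2 hR)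
  refine hsmul.congr' ?_ EventuallyEq.rfl
  filter_upwards [eventually_det_pencil_ne_zero (G := G) hD,
    eventually_det_pencil_ne_zero (G := Wᴴ * G * V) hDr] with t ht htr
  rw [Matrix.mul_sub, mul_pencilTf_eq_sub hL ht, mul_pencilTf_eq_sub hLr htr, hGr, hBr,
    sub_sub_sub_cancel_left, ← smul_sub]
  rfl

theorem reduced_pencilTf_hermite (hD : D.det ≠ 0) (hDr : (Wᴴ * D * V).det ≠ 0)
    (hV : ∃ Y : Matrix (Fin r) (Fin m) ℂ, V * Y = D⁻¹ * B)
    (hW : ∃ Z : Matrix (Fin r) (Fin m) ℂ, W * Z = Dᴴ⁻¹ * Cᴴ * (C * D⁻¹ * B)) :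
    (fun t ↦ ‖pencilTf (C * V) (Wᴴ * D * V) (Wᴴ * G * V) (Wᴴ * B) t‖ ^ 2
      - ‖pencilTf C D G B t‖ ^ 2) =o[𝓝 0] fun t : ℝ ↦ t :=
  norm_sq_sub_norm_sq_isLittleO (differentiableAt_pencilTf hD) (differentiableAt_pencilTf hDr)
    (reduced_pencilTf_zero hD hDr hV)
    (conjTranspose_mul_reduced_pencilTf_sub_isLittleO hD hDr hV (by rwa [pencilTf_zero]))

theorem det_reduced_conjTranspose_ne_zero (hDr : (Wᴴ * D * V).det ≠ 0) :
    (Vᴴ * Dᴴ * W).det ≠ 0 := by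
  simpa only [Matrix.conjTranspose_mul, Matrix.conjTranspose_conjTranspose, Matrix.mul_assoc]
    using det_conjTranspose_ne_zero hDr

theorem reduced_pencilTf_zero_of_left (hD : D.det ≠ 0) (hDr : (Wᴴ * D * V).det ≠ 0)
    (hW : ∃ Z : Matrix (Fin r) (Fin p) ℂ, W * Z = Dᴴ⁻¹ * Cᴴ) :
    pencilTf (C * V) (Wᴴ * D * V) (Wᴴ * G * V) (Wᴴ * B) 0 = pencilTf C D G B 0 := by
  rw [← Matrix.conjTranspose_inj, reduced_pencilTf_conjTranspose, pencilTf_conjTranspose]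
  exact reduced_pencilTf_zero (det_conjTranspose_ne_zero hD)
    (det_reduced_conjTranspose_ne_zero hDr) hW

theorem reduced_pencilTf_hermite_of_left (hD : D.det ≠ 0) (hDr : (Wᴴ * D * V).det ≠ 0)
    (hW : ∃ Z : Matrix (Fin r) (Fin p) ℂ, W * Z = Dᴴ⁻¹ * Cᴴ)
    (hV : ∃ Y : Matrix (Fin r) (Fin p) ℂ, V * Y = D⁻¹ * B * (C * D⁻¹ * B)ᴴ) :
    (fun t ↦ ‖pencilTf (C * V) (Wᴴ * D * V) (Wᴴ * G * V) (Wᴴ * B) t‖ ^ 2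
      - ‖pencilTf C D G B t‖ ^ 2) =o[𝓝 0] fun t : ℝ ↦ t := by
  have hV' : ∃ Y : Matrix (Fin r) (Fin p) ℂ, V * Y = Dᴴᴴ⁻¹ * Bᴴᴴ * (Bᴴ * Dᴴ⁻¹ * Cᴴ) := by
    simpa only [Matrix.conjTranspose_mul, Matrix.conjTranspose_conjTranspose,
      Matrix.conjTranspose_nonsing_inv, Matrix.mul_assoc] using hV
  refine (reduced_pencilTf_hermite (G := Gᴴ) (det_conjTranspose_ne_zero hD)
    (det_reduced_conjTranspose_ne_zero hDr) hW hV').congr_left fun t ↦ ?_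
  rw [← reduced_pencilTf_conjTranspose, ← pencilTf_conjTranspose, Matrix.l2_opNorm_conjTranspose,
    Matrix.l2_opNorm_conjTranspose]

end HermiteInterpolation

/-! ### Compactness of the set of admissible bases -/

section SystemCalculus

open scoped Matrix.Norms.L2Operator
open Asymptotics

theorem contDiffAt_matrix_combination {d κ a b : ℕ} {f : Fin κ → Par d → ℝ}
    {μ : Par d} (hf : ∀ i, AnalyticAt ℝ (f i) μ) (K : Fin κ → Matrix (Fin a) (Fin b) ℝ)
    (N : WithTop ℕ∞) :
    ContDiffAt ℝ N (fun μ ↦ (∑ i, f i μ • K i).map Complex.ofReal) μ := by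
  rw [contDiffAt_matrix]
  intro i j
  simp only [Matrix.map_apply, Matrix.sum_apply, Matrix.smul_apply, smul_eq_mul]
  have hsum : ContDiffAt ℝ N (fun μ ↦ ∑ k, f k μ * K k i j) μ :=
    ContDiffAt.sum fun k _ ↦ (hf k).contDiffAt.mul contDiffAt_const
  exact Complex.ofRealCLM.contDiff.contDiffAt.comp μ hsum

/-- The pairs `(V, W)` of matrices with `r` columns that define the reduced systems of order `r`. -/
abbrev BasisPair (n r : ℕ) := Matrix (Fin n) (Fin r) ℂ × Matrix (Fin n) (Fin r) ℂ

namespace ParamSystem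

variable {d n m p r : ℕ} (S : ParamSystem d n m p)

theorem redD_eq (V W : Matrix (Fin n) (Fin r) ℂ) (μ : Par d) (s : ℂ) :
    S.redD V W μ s = Wᴴ * S.D μ s * V := by
  simp [redD, D, Matrix.mul_sub, Matrix.sub_mul]

theorem redD_one (μ : Par d) (s : ℂ) : S.redD 1 1 μ s = S.D μ s := by
  simp [redD_eq]

theorem redH_one (μ : Par d) (s : ℂ) : S.redH (1 : Matrix (Fin n) (Fin n) ℂ) 1 μ s = S.H μ s := by
  simp [redH, H, redD_one]

theorem redSigma_one : S.redSigma (1 : Matrix (Fin n) (Fin n) ℂ) 1 = S.sigma := by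
  funext μ ω; rw [redSigma, sigma, redH_one]

theorem redSigma2_one : S.redSigma2 (1 : Matrix (Fin n) (Fin n) ℂ) 1 = S.sigma2 := by
  funext μ ω; rw [redSigma2, sigma2, redH_one]

/-- `σ^{V,W}(μ, ω)` as a function of `(((V, W), μ), ω)`, so that the bases can be treated as
parameters as well. The full system is the special case `V = W = 1`. -/
noncomputable def redFun (r : ℕ) (z : (BasisPair n r × Par d) × ℝ) : ℝ :=
  S.redSigma z.1.1.1 z.1.1.2 z.1.2 z.2

/-- The gap `σ^{V,W} - σ₂^{V,W}` as a function of `(((V, W), μ), ω)`. -/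
noncomputable def redGap (r : ℕ) (z : (BasisPair n r × Par d) × ℝ) : ℝ :=
  S.redSigma z.1.1.1 z.1.1.2 z.1.2 z.2 - S.redSigma2 z.1.1.1 z.1.1.2 z.1.2 z.2

/-- The transfer function of the reduced system with bases `(V, W)` is defined at `(μ, iω)`, and the
gap between its two largest singular values is larger than `ε` there. -/
def RedRegular (r : ℕ) (ε : ℝ) (z : (BasisPair n r × Par d) × ℝ) : Prop :=
  z.1.2 ∈ S.Ω ∧ (S.redD z.1.1.1 z.1.1.2 z.1.2 (Complex.I * z.2)).det ≠ 0 ∧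
    ε < S.redGap r z

variable {z : (BasisPair n r × Par d) × ℝ} {N : WithTop ℕ∞} {μ : Par d}

theorem contDiffAt_E (hμ : μ ∈ S.Ω) : ContDiffAt ℝ N S.E μ :=
  contDiffAt_matrix_combination (fun i ↦ S.f_analytic i μ hμ) S.Emat N

theorem contDiffAt_A (hμ : μ ∈ S.Ω) : ContDiffAt ℝ N S.A μ :=
  contDiffAt_matrix_combination (fun i ↦ S.g_analytic i μ hμ) S.Amat N

theorem contDiffAt_B (hμ : μ ∈ S.Ω) : ContDiffAt ℝ N S.B μ :=
  contDiffAt_matrix_combination (fun i ↦ S.h_analytic i μ hμ) S.Bmat N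

theorem contDiffAt_C (hμ : μ ∈ S.Ω) : ContDiffAt ℝ N S.C μ :=
  contDiffAt_matrix_combination (fun i ↦ S.l_analytic i μ hμ) S.Cmat N

theorem contDiffAt_redD (hμ : z.1.2 ∈ S.Ω) :
    ContDiffAt ℝ N (fun z : (BasisPair n r × Par d) × ℝ ↦
      S.redD z.1.1.1 z.1.1.2 z.1.2 (Complex.I * z.2)) z := by
  have hs : ContDiffAt ℝ N (fun z : (BasisPair n r × Par d) × ℝ ↦ Complex.I * (z.2 : ℂ)) z :=
    contDiffAt_const.mul (Complex.ofRealCLM.contDiff.contDiffAt.comp z contDiffAt_snd)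
  have hE := (S.contDiffAt_E (N := N) hμ).comp z (contDiffAt_snd.comp z contDiffAt_fst)
  have hA := (S.contDiffAt_A (N := N) hμ).comp z (contDiffAt_snd.comp z contDiffAt_fst)
  have hsandwich {M : (BasisPair n r × Par d) × ℝ → Matrix (Fin n) (Fin n) ℂ}
      (hM : ContDiffAt ℝ N M z) : ContDiffAt ℝ N (fun z ↦ z.1.1.2ᴴ * M z * z.1.1.1) z :=
    contDiffAt_matrix_mul (contDiffAt_matrix_mul
      (contDiffAt_matrix_conjTranspose (by fun_prop)) hM) (by fun_prop)
  exact (hs.smul (hsandwich hE)).sub (hsandwich hA)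

theorem contDiffAt_redH (hμ : z.1.2 ∈ S.Ω)
    (hD : (S.redD z.1.1.1 z.1.1.2 z.1.2 (Complex.I * z.2)).det ≠ 0) :
    ContDiffAt ℝ N (fun z : (BasisPair n r × Par d) × ℝ ↦
      S.redH z.1.1.1 z.1.1.2 z.1.2 (Complex.I * z.2)) z := by
  have hB := (S.contDiffAt_B (N := N) hμ).comp z (contDiffAt_snd.comp z contDiffAt_fst)
  have hC := (S.contDiffAt_C (N := N) hμ).comp z (contDiffAt_snd.comp z contDiffAt_fst)
  exact contDiffAt_matrix_mul (contDiffAt_matrix_mul (contDiffAt_matrix_mul hC (by fun_prop))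
    (contDiffAt_matrix_inv (S.contDiffAt_redD hμ) hD))
    (contDiffAt_matrix_mul (contDiffAt_matrix_conjTranspose (by fun_prop)) hB)

theorem continuousAt_redGap (hμ : z.1.2 ∈ S.Ω)
    (hD : (S.redD z.1.1.1 z.1.1.2 z.1.2 (Complex.I * z.2)).det ≠ 0) :
    ContinuousAt (S.redGap r) z := by
  have hH := (S.contDiffAt_redH (N := 0) hμ hD).continuousAt
  exact ((continuous_singVal 0).continuousAt.comp hH).sub
    ((continuous_singVal 1).continuousAt.comp hH)

theorem eventually_det_redD_ne_zero (hμ : z.1.2 ∈ S.Ω)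
    (hD : (S.redD z.1.1.1 z.1.1.2 z.1.2 (Complex.I * z.2)).det ≠ 0) :
    ∀ᶠ z : (BasisPair n r × Par d) × ℝ in 𝓝 z,
      (S.redD z.1.1.1 z.1.1.2 z.1.2 (Complex.I * z.2)).det ≠ 0 :=
  (contDiffAt_matrix_det (S.contDiffAt_redD (N := 0) hμ)).continuousAt.eventually_ne hD

variable {S}

theorem RedRegular.eventually {ε : ℝ} (h : S.RedRegular r ε z) :
    ∀ᶠ y in 𝓝 z, S.RedRegular r ε y := by
  obtain ⟨hμ, hD, hgap⟩ := h
  have hΩ : ∀ᶠ y : (BasisPair n r × Par d) × ℝ in 𝓝 z, y.1.2 ∈ S.Ω :=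
    (continuous_snd.comp continuous_fst).continuousAt.eventually (S.isOpen.mem_nhds hμ)
  exact hΩ.and <| (S.eventually_det_redD_ne_zero hμ hD).and <|
    (S.continuousAt_redGap hμ hD).eventually_const_lt hgap

theorem RedRegular.contDiffAt {ε : ℝ} (h : S.RedRegular r ε z) (hε : 0 ≤ ε) :
    ContDiffAt ℝ N (S.redFun r) z :=
  (contDiffAt_sigMax (sub_pos.1 (hε.trans_lt h.2.2))).comp z (S.contDiffAt_redH h.1 h.2.1)

variable (S)

theorem iteratedDeriv_two_redSigma (V W : Matrix (Fin n) (Fin r) ℂ) (μ : Par d) (ω : ℝ) :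
    iteratedDeriv 2 (S.redSigma V W μ) ω = derivSnd (derivSnd (S.redFun r)) (((V, W), μ), ω) := by
  rw [iteratedDeriv_succ, iteratedDeriv_one]
  rfl

theorem D_add (μ : Par d) (ω t : ℝ) :
    S.D μ (Complex.I * (ω + t : ℝ)) = S.D μ (Complex.I * ω) + (t : ℂ) • (Complex.I • S.E μ) := by
  simp only [D, smul_smul]
  push_cast
  rw [mul_add, add_smul, mul_comm (t : ℂ)]
  abel

theorem H_add (μ : Par d) (ω t : ℝ) : S.H μ (Complex.I * (ω + t : ℝ)) =
    pencilTf (S.C μ) (S.D μ (Complex.I * ω)) (Complex.I • S.E μ) (S.B μ) t := by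
  rw [H, D_add, pencilTf]

theorem redH_add (V W : Matrix (Fin n) (Fin r) ℂ) (μ : Par d) (ω t : ℝ) :
    S.redH V W μ (Complex.I * (ω + t : ℝ)) = pencilTf (S.C μ * V)
      (Wᴴ * S.D μ (Complex.I * ω) * V) (Wᴴ * (Complex.I • S.E μ) * V) (Wᴴ * S.B μ) t := by
  rw [redH, redD_eq, D_add, pencilTf]
  simp only [Matrix.mul_add, Matrix.add_mul, Matrix.mul_smul, Matrix.smul_mul]

variable {V W : Matrix (Fin n) (Fin r) ℂ} {ω : ℝ} {S}

theorem exists_mul_eq_right (hm : ¬ p < m) (hV : S.expandV μ ω ≤ colSpace V) :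
    ∃ Y : Matrix (Fin r) (Fin m) ℂ, V * Y = (S.D μ (Complex.I * ω))⁻¹ * S.B μ :=
  exists_mul_eq_of_colSpace_le (by rwa [expandV, if_neg hm] at hV)

theorem exists_mul_eq_left (hp : ¬ m < p) (hW : S.expandW μ ω ≤ colSpace W) :
    ∃ Z : Matrix (Fin r) (Fin p) ℂ, W * Z = (S.D μ (Complex.I * ω))ᴴ⁻¹ * (S.C μ)ᴴ :=
  exists_mul_eq_of_colSpace_le (by rwa [expandW, if_neg hp] at hW)

theorem exists_mul_eq_left_mul_H (hW : S.expandW μ ω ≤ colSpace W) :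
    ∃ Z : Matrix (Fin r) (Fin m) ℂ,
      W * Z = (S.D μ (Complex.I * ω))ᴴ⁻¹ * (S.C μ)ᴴ * S.H μ (Complex.I * ω) := by
  by_cases h : m < p
  · exact exists_mul_eq_of_colSpace_le (by rwa [expandW, if_pos h] at hW)
  · obtain ⟨Z, hZ⟩ := exists_mul_eq_left h hW
    exact ⟨Z * S.H μ (Complex.I * ω), by rw [← Matrix.mul_assoc, hZ]⟩

theorem redH_eq_H (hV : S.expandV μ ω ≤ colSpace V) (hW : S.expandW μ ω ≤ colSpace W)
    (hD : (S.D μ (Complex.I * ω)).det ≠ 0) (hDr : (S.redD V W μ (Complex.I * ω)).det ≠ 0) :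
    S.redH V W μ (Complex.I * ω) = S.H μ (Complex.I * ω) := by
  rw [redD_eq] at hDr
  have hred := S.redH_add V W μ ω 0
  have hfull := S.H_add μ ω 0
  rw [add_zero] at hred hfull
  rw [hred, hfull]
  by_cases h : p < m
  · exact reduced_pencilTf_zero_of_left hD hDr (exists_mul_eq_left h.not_gt hW)
  · exact reduced_pencilTf_zero hD hDr (exists_mul_eq_right h hV)

theorem redSigma_sq_sub_sigma_sq_isLittleO (hV : S.expandV μ ω ≤ colSpace V)
    (hW : S.expandW μ ω ≤ colSpace W) (hD : (S.D μ (Complex.I * ω)).det ≠ 0)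
    (hDr : (S.redD V W μ (Complex.I * ω)).det ≠ 0) :
    (fun t : ℝ ↦ S.redSigma V W μ (ω + t) ^ 2 - S.sigma μ (ω + t) ^ 2) =o[𝓝 0]
      fun t : ℝ ↦ t := by
  rw [redD_eq] at hDr
  simp only [redSigma, sigma, sigMax_eq_norm, redH_add, H_add]
  by_cases h : p < m
  · rw [expandV, if_pos h] at hV
    exact reduced_pencilTf_hermite_of_left hD hDr (exists_mul_eq_left h.not_gt hW)
      (exists_mul_eq_of_colSpace_le hV)
  · exact reduced_pencilTf_hermite hD hDr (exists_mul_eq_right h hV) (exists_mul_eq_left_mul_H hW)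

theorem hasDerivAt_redSigma_zero (hV : S.expandV μ ω ≤ colSpace V)
    (hW : S.expandW μ ω ≤ colSpace W) (hD : (S.D μ (Complex.I * ω)).det ≠ 0)
    (hDr : (S.redD V W μ (Complex.I * ω)).det ≠ 0) (hne : S.sigma μ ω ≠ 0)
    (hσ : HasDerivAt (S.sigma μ) 0 ω) (hred : DifferentiableAt ℝ (S.redSigma V W μ) ω) :
    HasDerivAt (S.redSigma V W μ) 0 ω := by
  have heq : S.redSigma V W μ ω = S.sigma μ ω := by rw [redSigma, redH_eq_H hV hW hD hDr, sigma]
  have hdiff : HasDerivAt (fun x ↦ S.redSigma V W μ x ^ 2 - S.sigma μ x ^ 2) 0 ω := by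
    rw [hasDerivAt_iff_isLittleO_nhds_zero]
    refine (redSigma_sq_sub_sigma_sq_isLittleO hV hW hD hDr).congr_left fun t ↦ ?_
    simp [heq]
  have hsq := hdiff.unique ((hred.hasDerivAt.pow 2).sub (hσ.pow 2))
  have hderiv : deriv (S.redSigma V W μ) ω = 0 := by
    rw [heq] at hsq
    simpa [hne] using hsq.symm
  exact hderiv ▸ hred.hasDerivAt

end ParamSystem

end SystemCalculus

section Compactness

open scoped Matrix.Norms.L2Operator

theorem le_of_conjTranspose_mul_self_eq_one {a b : ℕ} {V : Matrix (Fin a) (Fin b) ℂ}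
    (h : Vᴴ * V = 1) : b ≤ a := by
  have hinj : Function.Injective V.mulVecLin := fun x y hxy ↦ by
    simpa [Matrix.mulVec_mulVec, h] using congrArg (Vᴴ *ᵥ ·) hxy
  simpa using LinearMap.finrank_le_finrank_of_injective hinj

theorem norm_le_of_conjTranspose_mul_self_eq_one {a b : ℕ} {V : Matrix (Fin a) (Fin b) ℂ}
    (h : Vᴴ * V = 1) : ‖V‖ ≤ ‖(1 : Matrix (Fin b) (Fin b) ℂ)‖ + 1 := by
  have hsq := Matrix.l2_opNorm_conjTranspose_mul_self V
  rw [h] at hsq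
  nlinarith [norm_nonneg V, sq_nonneg (‖V‖ - 1)]

theorem continuous_toEuclideanLin_apply {a b : ℕ} (x : EuclideanSpace ℂ (Fin b)) :
    Continuous fun M : Matrix (Fin a) (Fin b) ℂ ↦ Matrix.toEuclideanLin M x :=
  (LinearMap.applyₗ x ∘ₗ Matrix.toEuclideanLin.toLinearMap).continuous_of_finiteDimensional

namespace ParamSystem

variable {d n m p : ℕ} (S : ParamSystem d n m p) (μs : Par d) (ωs β ε δ : ℝ) (r : ℕ)

/-- The pairs of orthonormal bases with `σ_min(D^{V,W}(μs, iωs)) ≥ β`. The bound is expressed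
without `sigMin` so that it makes sense, and excludes no pair, also for `r = 0`. -/
def reducers : Set (BasisPair n r) :=
  {θ | θ.1ᴴ * θ.1 = 1 ∧ θ.2ᴴ * θ.2 = 1 ∧ ∀ x : EuclideanSpace ℂ (Fin r),
    β * ‖x‖ ≤ ‖Matrix.toEuclideanLin (S.redD θ.1 θ.2 μs (Complex.I * ωs)) x‖}

/-- The members of `reducers` with `(σ - σ₂)^{V,W} ≥ 2ε` and `σ^{V,W}_{ωω} ≤ δ` at `(μs, ωs)`. This
compact set parametrizes all reduced systems for which uniform estimates are derived. -/
def gapReducers : Set (BasisPair n r) :=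
  {θ ∈ S.reducers μs ωs β r | 2 * ε ≤ S.redGap r ((θ, μs), ωs) ∧
    derivSnd (derivSnd (S.redFun r)) ((θ, μs), ωs) ≤ δ}

variable {μs ωs β ε δ r}

theorem isClosed_reducers : IsClosed (S.reducers μs ωs β r) := by
  have hV : Continuous fun θ : BasisPair n r ↦ θ.1ᴴ := continuous_fst.matrix_conjTranspose
  have hW : Continuous fun θ : BasisPair n r ↦ θ.2ᴴ := continuous_snd.matrix_conjTranspose
  have hD : Continuous fun θ : BasisPair n r ↦ S.redD θ.1 θ.2 μs (Complex.I * ωs) := by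
    simp only [redD_eq]
    exact (hW.matrix_mul continuous_const).matrix_mul continuous_fst
  simp only [reducers, ofPred_and, ofPred_forall]
  exact (isClosed_eq (hV.matrix_mul continuous_fst) continuous_const).inter <|
    (isClosed_eq (hW.matrix_mul continuous_snd) continuous_const).inter <|
    isClosed_iInter fun x ↦
      isClosed_le continuous_const ((continuous_toEuclideanLin_apply x).comp hD).norm

theorem isCompact_reducers : IsCompact (S.reducers μs ωs β r) := by
  have : ProperSpace (BasisPair n r) := FiniteDimensional.proper ℂ _
  refine Metric.isCompact_of_isClosed_isBounded S.isClosed_reducers ?_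
  refine (Metric.isBounded_closedBall (x := (0 : BasisPair n r))
    (r := ‖(1 : Matrix (Fin r) (Fin r) ℂ)‖ + 1)).subset fun θ hθ ↦ ?_
  rw [mem_closedBall_zero_iff, Prod.norm_def, max_le_iff]
  exact ⟨norm_le_of_conjTranspose_mul_self_eq_one hθ.1,
    norm_le_of_conjTranspose_mul_self_eq_one hθ.2.1⟩

variable {S} {θ : BasisPair n r}

theorem det_ne_zero_of_mem_reducers (hβ : 0 < β) (hθ : θ ∈ S.reducers μs ωs β r) :
    (S.redD θ.1 θ.2 μs (Complex.I * ωs)).det ≠ 0 :=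
  det_ne_zero_of_mul_norm_le hβ hθ.2.2

theorem redRegular_of_mem_reducers (hμs : μs ∈ S.Ω) (hβ : 0 < β) (hε : 0 < ε)
    (hθ : θ ∈ S.reducers μs ωs β r) (hgap : 2 * ε ≤ S.redGap r ((θ, μs), ωs)) :
    S.RedRegular r ε ((θ, μs), ωs) :=
  ⟨hμs, det_ne_zero_of_mem_reducers hβ hθ, by linarith⟩

theorem continuousOn_redGap_reducers (hμs : μs ∈ S.Ω) (hβ : 0 < β) :
    ContinuousOn (fun θ ↦ S.redGap r ((θ, μs), ωs)) (S.reducers μs ωs β r) := fun θ hθ ↦ by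
  have hcont := S.continuousAt_redGap (z := ((θ, μs), ωs)) hμs (det_ne_zero_of_mem_reducers hβ hθ)
  exact (hcont.comp (f := fun θ ↦ ((θ, μs), ωs)) (by fun_prop)).continuousWithinAt

theorem isCompact_gapReducers (hμs : μs ∈ S.Ω) (hβ : 0 < β) (hε : 0 < ε) :
    IsCompact (S.gapReducers μs ωs β ε δ r) := by
  have hgap : IsCompact {θ ∈ S.reducers μs ωs β r | 2 * ε ≤ S.redGap r ((θ, μs), ωs)} :=
    S.isCompact_reducers.of_isClosed_subset
      ((continuousOn_redGap_reducers hμs hβ).preimage_isClosed_of_isClosed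
        S.isClosed_reducers isClosed_Ici) (sep_subset _ _)
  have hderiv : ContinuousOn (fun θ ↦ derivSnd (derivSnd (S.redFun r)) ((θ, μs), ωs))
      {θ ∈ S.reducers μs ωs β r | 2 * ε ≤ S.redGap r ((θ, μs), ωs)} := fun θ hθ ↦ by
    have hreg := redRegular_of_mem_reducers hμs hβ hε hθ.1 hθ.2
    have hcont := (contDiffAt_derivSnd (k := 0) (contDiffAt_derivSnd (k := 1)
      (hreg.contDiffAt hε.le))).continuousAt
    exact (hcont.comp (f := fun θ ↦ ((θ, μs), ωs)) (by fun_prop)).continuousWithinAt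
  have hsep := hgap.of_isClosed_subset
    (hderiv.preimage_isClosed_of_isClosed hgap.isClosed (isClosed_Iic (a := δ))) inter_subset_left
  convert hsep using 1
  ext θ
  exact and_assoc.symm

variable (S)

theorem eventually_det_redD_ne_zero_of_mem_reducers (hμs : μs ∈ S.Ω) (hβ : 0 < β) :
    ∀ᶠ v : Par d × ℝ in 𝓝 (μs, ωs), ∀ θ ∈ S.reducers μs ωs β r,
      (S.redD θ.1 θ.2 v.1 (Complex.I * v.2)).det ≠ 0 := by
  refine S.isCompact_reducers.eventually_forall_of_forall_eventually fun θ hθ ↦ ?_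
  have hswap : Tendsto (fun u : (Par d × ℝ) × BasisPair n r ↦ ((u.2, u.1.1), u.1.2))
      (𝓝 ((μs, ωs), θ)) (𝓝 ((θ, μs), ωs)) := Continuous.tendsto (by fun_prop) ((μs, ωs), θ)
  exact hswap.eventually
    (S.eventually_det_redD_ne_zero hμs (det_ne_zero_of_mem_reducers hβ hθ))

theorem eventually_redGap_lt_add (hμs : μs ∈ S.Ω) (hβ : 0 < β) (hε : 0 < ε) :
    ∀ᶠ v : Par d × ℝ in 𝓝 (μs, ωs), ∀ θ ∈ S.reducers μs ωs β r,
      S.redGap r ((θ, v.1), v.2) < S.redGap r ((θ, μs), ωs) + ε := by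
  have hcont : ∀ θ ∈ S.reducers μs ωs β r, ContinuousAt
      (fun u : BasisPair n r × (Par d × ℝ) ↦ S.redGap r ((u.1, u.2.1), u.2.2)) (θ, (μs, ωs)) := by
    intro θ hθ
    have hgap := S.continuousAt_redGap (z := ((θ, μs), ωs)) hμs (det_ne_zero_of_mem_reducers hβ hθ)
    exact hgap.comp (f := fun u : BasisPair n r × (Par d × ℝ) ↦ ((u.1, u.2.1), u.2.2))
      (x := (θ, (μs, ωs))) (by fun_prop)
  have hpair : Tendsto (fun v : Par d × ℝ ↦ (v, (μs, ωs))) (𝓝 (μs, ωs))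
      (𝓝 ((μs, ωs), (μs, ωs))) := Continuous.tendsto (by fun_prop) (μs, ωs)
  filter_upwards [hpair.eventually (eventually_forall_abs_sub_lt S.isCompact_reducers hcont hε)]
    with v hv θ hθ
  linarith [(abs_lt.1 (hv θ hθ)).2]

end ParamSystem

end Compactness

/-! ### The `H∞`-norm -/

section HalfPlane

open Polynomial

theorem eventually_eval_ne_zero {Q : ℂ[X]} (hQ : Q ≠ 0) (s : ℂ) {v : ℂ} (hv : v ≠ 0) :
    ∀ᶠ t : ℝ in 𝓝[>] 0, Q.eval (s + t * v) ≠ 0 := by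
  have hcofinite : ∀ᶠ z in cofinite, Q.eval z ≠ 0 :=
    (finite_setOfPred_isRoot hQ).subset fun z hz ↦ not_not.1 hz
  have hinj : Function.Injective fun t : ℝ ↦ s + t * v := fun a b hab ↦ by simpa [hv] using hab
  have hle : 𝓝[>] (0 : ℝ) ≤ cofinite :=
    (nhdsWithin_mono 0 fun t ht ↦ ne_of_gt ht).trans (nhdsNE_le_cofinite 0)
  exact (hinj.tendsto_cofinite.mono_left hle).eventually hcofinite

theorem tendsto_add_ofReal_mul (s v : ℂ) :
    Tendsto (fun t : ℝ ↦ s + (t : ℂ) * v) (𝓝[>] 0) (𝓝 s) := by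
  have hcont : Continuous fun t : ℝ ↦ s + (t : ℂ) * v := by fun_prop
  simpa using (hcont.tendsto 0).mono_left nhdsWithin_le_nhds

theorem norm_eval_le_of_direction {P Q g : ℂ[X]} (hgQ : g * Q ≠ 0) {M : ℝ} {s v : ℂ} (hv : v ≠ 0)
    (h : ∀ t : ℝ, 0 < t → (g * Q).eval (s + t * v) ≠ 0 →
      ‖(g * P).eval (s + t * v) / (g * Q).eval (s + t * v)‖ ≤ M) :
    ‖P.eval s‖ ≤ M * ‖Q.eval s‖ := by
  have hP := (P.continuous.norm.tendsto s).comp (tendsto_add_ofReal_mul s v)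
  have hQ := ((Q.continuous.norm.tendsto s).comp (tendsto_add_ofReal_mul s v)).const_mul M
  refine le_of_tendsto_of_tendsto hP hQ ?_
  filter_upwards [eventually_eval_ne_zero hgQ s hv, self_mem_nhdsWithin] with t ht htpos
  have hbound := h t htpos ht
  rw [eval_mul] at ht
  rwa [eval_mul, eval_mul, mul_div_mul_left _ _ (left_ne_zero_of_mul ht), norm_div,
    div_le_iff₀ (norm_pos_iff.2 (right_ne_zero_of_mul ht))] at hbound

theorem norm_eval_le_of_isCoprime {P Q : ℂ[X]} (hPQ : IsCoprime P Q) {M c : ℝ}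
    (hM : ∀ z : ℂ, 0 ≤ z.re → ‖P.eval z‖ ≤ M * ‖Q.eval z‖)
    (hc : ∀ ω : ℝ, ‖P.eval (Complex.I * ω)‖ ≤ c * ‖Q.eval (Complex.I * ω)‖)
    {s : ℂ} (hs : 0 ≤ s.re) : ‖P.eval s‖ ≤ c * ‖Q.eval s‖ := by
  have hQ (z : ℂ) (hz : 0 ≤ z.re) : Q.eval z ≠ 0 := fun hQz ↦ by
    have hPz : P.eval z = 0 := by simpa [hQz] using hM z hz
    obtain ⟨a, b, hab⟩ := hPQ
    simpa [hPz, hQz] using congrArg (eval z) hab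
  have hbound {z : ℂ} (hz : 0 ≤ z.re) {b : ℝ} :
      ‖P.eval z / Q.eval z‖ ≤ b ↔ ‖P.eval z‖ ≤ b * ‖Q.eval z‖ := by
    rw [norm_div, div_le_iff₀ (norm_pos_iff.2 (hQ z hz))]
  have hdiff : DiffContOnCl ℂ (fun z ↦ P.eval z / Q.eval z) {z | 0 < z.re} := by
    refine DifferentiableOn.diffContOnCl fun z hz ↦ ?_
    rw [Complex.closure_setOfPred_lt_re] at hz
    exact (P.differentiable.differentiableAt.div Q.differentiable.differentiableAt
      (hQ z hz)).differentiableWithinAt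
  refine (hbound hs).1 (PhragmenLindelof.right_half_plane_of_bounded_on_real
    (f := fun z ↦ P.eval z / Q.eval z) hdiff ⟨1, one_lt_two, 0, Asymptotics.IsBigO.of_bound M ?_⟩
    (isBoundedUnder_of_eventually_le (a := M) ?_) (fun ω ↦ ?_) hs)
  · exact eventually_inf_principal.2 (.of_forall fun z hz ↦ by
      simpa using (hbound (le_of_lt hz)).2 (hM z (le_of_lt hz)))
  · filter_upwards [eventually_ge_atTop 0] with x hx
    exact (hbound (by simpa using hx)).2 (hM x (by simpa using hx))
  · rw [mul_comm]
    exact (hbound (by simp)).2 (hc ω)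

theorem exists_eq_mul_isCoprime (P Q : ℂ[X]) :
    ∃ g P' Q' : ℂ[X], P = g * P' ∧ Q = g * Q' ∧ IsCoprime P' Q' := by
  let := UniqueFactorizationMonoid.toGCDMonoid ℂ[X]
  obtain ⟨P', Q', hP, hQ, hunit⟩ := extract_gcd P Q
  exact ⟨_, P', Q', hP, hQ, (gcd_isUnit_iff P' Q').1 hunit⟩

theorem norm_eval_div_le_of_imaginary_axis {P Q : ℂ[X]} {M c : ℝ}
    (hM : ∀ s : ℂ, 0 < s.re → Q.eval s ≠ 0 → ‖P.eval s / Q.eval s‖ ≤ M)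
    (hc : ∀ ω : ℝ, Q.eval (Complex.I * ω) ≠ 0 →
      ‖P.eval (Complex.I * ω) / Q.eval (Complex.I * ω)‖ ≤ c)
    {s : ℂ} (hs : 0 < s.re) (hQs : Q.eval s ≠ 0) : ‖P.eval s / Q.eval s‖ ≤ c := by
  have hQ : Q ≠ 0 := by rintro rfl; exact hQs eval_zero
  obtain ⟨g, P', Q', rfl, rfl, hcop⟩ := exists_eq_mul_isCoprime P Q
  have hM' (z : ℂ) (hz : 0 ≤ z.re) : ‖P'.eval z‖ ≤ M * ‖Q'.eval z‖ :=
    norm_eval_le_of_direction hQ one_ne_zero fun t ht ↦ hM _ (by simp; linarith)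
  have hc' (ω : ℝ) : ‖P'.eval (Complex.I * ω)‖ ≤ c * ‖Q'.eval (Complex.I * ω)‖ :=
    norm_eval_le_of_direction hQ Complex.I_ne_zero fun t _ ↦ by
      simpa [mul_add, mul_comm] using hc (ω + t)
  rw [eval_mul] at hQs
  rw [eval_mul, eval_mul, mul_div_mul_left _ _ (left_ne_zero_of_mul hQs), norm_div,
    div_le_iff₀ (norm_pos_iff.2 (right_ne_zero_of_mul hQs))]
  exact norm_eval_le_of_isCoprime hcop hM' hc' hs.le

end HalfPlane

section HinfNorm

open scoped Matrix.Norms.L2Operator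
open Polynomial

theorem opNorm_le_of_norm_inner_le {𝕜 E F : Type*} [RCLike 𝕜] [NormedAddCommGroup E]
    [NormedSpace 𝕜 E] [NormedAddCommGroup F] [InnerProductSpace 𝕜 F] {T : E →L[𝕜] F} {c : ℝ}
    (hc : 0 ≤ c) (h : ∀ u v, ‖inner 𝕜 u (T v)‖ ≤ c * ‖v‖ * ‖u‖) : ‖T‖ ≤ c := by
  refine T.opNorm_le_bound hc fun v ↦ ?_
  rw [← innerSL_apply_norm 𝕜 (T v)]
  exact (innerSL 𝕜 (T v)).opNorm_le_bound (by positivity) fun u ↦ by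
    simpa [norm_inner_symm] using h u v

/-- Where the pencil is singular, both sides of the last equation are junk values `0`. -/
theorem exists_polynomial_inner_eq {n m p : ℕ} (E A : Matrix (Fin n) (Fin n) ℂ)
    (B : Matrix (Fin n) (Fin m) ℂ) (C : Matrix (Fin p) (Fin n) ℂ) :
    ∃ Q : ℂ[X], (∀ s, Q.eval s = (s • E - A).det) ∧ ∀ u v, ∃ P : ℂ[X], ∀ s,
      P.eval s / Q.eval s = inner ℂ u (Matrix.toEuclideanLin (C * (s • E - A)⁻¹ * B) v) := by
  let D : Matrix (Fin n) (Fin n) ℂ[X] := (X : ℂ[X]) • E.map Polynomial.C - A.map Polynomial.C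
  have hD (s : ℂ) : (evalRingHom s).mapMatrix D = s • E - A := by
    ext i j
    simp [D]
    ring
  have hdet (s : ℂ) : D.det.eval s = (s • E - A).det := by
    rw [← hD, ← RingHom.map_det]
    rfl
  let N : Matrix (Fin p) (Fin m) ℂ[X] := C.map Polynomial.C * D.adjugate * B.map Polynomial.C
  have hN (s : ℂ) (i : Fin p) (j : Fin m) :
      (N i j).eval s = (C * (s • E - A).adjugate * B) i j := by
    rw [← hD, ← RingHom.map_adjugate]
    simp [N, Matrix.mul_apply, eval_finsetSum]
  refine ⟨D.det, hdet, fun u v ↦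
    ⟨∑ i, (∑ j, N i j * Polynomial.C (v j)) * Polynomial.C (star (u i)), fun s ↦ ?_⟩⟩
  rw [EuclideanSpace.inner_eq_star_dotProduct, Matrix.toLpLin_apply, Matrix.inv_def,
    Ring.inverse_eq_inv', Matrix.mul_smul, Matrix.smul_mul, Matrix.smul_mulVec, smul_dotProduct,
    smul_eq_mul, div_eq_inv_mul, hdet]
  congr 1
  simp only [eval_finsetSum, eval_mul, eval_C, hN, dotProduct, Matrix.mulVec, Pi.star_apply]

namespace ParamSystem

variable {d n m p : ℕ} {S : ParamSystem d n m p} {μ : Par d} {s : ℂ}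

theorem H_eq_zero (h : (S.D μ s).det = 0) : S.H μ s = 0 := by
  rw [H, Matrix.nonsing_inv_apply_not_isUnit _ (by simp [h]), Matrix.mul_zero, Matrix.zero_mul]

theorem norm_H_le_hinfNorm (h : S.InHinf μ) (hs : 0 < s.re) : ‖S.H μ s‖ ≤ S.hinfNorm μ := by
  rw [← sigMax_eq_norm, hinfNorm, ← ENNReal.ofReal_le_iff_le_toReal h.2.ne]
  exact le_iSup (fun s : {s : ℂ // 0 < s.re} ↦ ENNReal.ofReal (sigMax (S.H μ s))) ⟨s, hs⟩

theorem norm_H_le_of_imaginary_axis (h : S.InHinf μ) {c : ℝ} (hc : ∀ ω : ℝ, S.sigma μ ω ≤ c)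
    (hs : 0 < s.re) : ‖S.H μ s‖ ≤ c := by
  have hc₀ : 0 ≤ c := (singVal_nonneg _ 0).trans (hc 0)
  by_cases hdet : (S.D μ s).det = 0
  · rwa [H_eq_zero hdet, norm_zero]
  obtain ⟨Q, hQ, hP⟩ := exists_polynomial_inner_eq (S.E μ) (S.A μ) (S.B μ) (S.C μ)
  refine opNorm_le_of_norm_inner_le hc₀ fun u v ↦ ?_
  obtain ⟨P, hP⟩ := hP u v
  have hbound {z : ℂ} {b : ℝ} (hb : ‖S.H μ z‖ ≤ b) :
      ‖P.eval z / Q.eval z‖ ≤ b * ‖v‖ * ‖u‖ := by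
    rw [hP z, mul_comm]
    refine (norm_inner_le_norm _ _).trans ?_
    gcongr
    exact (Matrix.l2_opNorm_mulVec (S.H μ z) v).trans (by gcongr)
  have hQs : Q.eval s ≠ 0 := hQ s ▸ hdet
  have haxis (ω : ℝ) : ‖S.H μ (Complex.I * ω)‖ ≤ c := sigMax_eq_norm (S.H μ _) ▸ hc ω
  have hmax := norm_eval_div_le_of_imaginary_axis
    (fun z hz _ ↦ hbound (norm_H_le_hinfNorm h hz)) (fun ω _ ↦ hbound (haxis ω)) hs hQs
  rwa [hP s] at hmax

theorem continuousAt_H (hD : (S.D μ s).det ≠ 0) : ContinuousAt (S.H μ) s := by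
  have hD' : ContDiffAt ℝ 0 (S.D μ) s := (contDiffAt_id.smul contDiffAt_const).sub contDiffAt_const
  exact (contDiffAt_matrix_mul (contDiffAt_matrix_mul contDiffAt_const
    (contDiffAt_matrix_inv hD' hD)) contDiffAt_const).continuousAt

theorem hinfNorm_eq_sigma (h : S.InHinf μ) {w : ℝ} (hD : (S.D μ (Complex.I * w)).det ≠ 0)
    (hmax : ∀ ω, S.sigma μ ω ≤ S.sigma μ w) : S.hinfNorm μ = S.sigma μ w := by
  refine le_antisymm (ENNReal.toReal_le_of_le_ofReal (singVal_nonneg _ 0) ?_) ?_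
  · refine iSup_le fun s ↦ ENNReal.ofReal_le_ofReal ?_
    exact sigMax_eq_norm (S.H μ s) ▸ norm_H_le_of_imaginary_axis h hmax s.2
  · rw [sigma, sigMax_eq_norm]
    refine le_of_tendsto ((continuousAt_H hD).norm.tendsto.comp (tendsto_add_ofReal_mul _ 1)) ?_
    filter_upwards [self_mem_nhdsWithin] with t ht
    exact norm_H_le_hinfNorm h (by simpa using ht)

end ParamSystem

end HinfNorm

section MaximalFrequency

open scoped Matrix.Norms.L2Operator

theorem map_star_mul {a b c : ℕ} (M : Matrix (Fin a) (Fin b) ℂ) (N : Matrix (Fin b) (Fin c) ℂ) :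
    (M * N).map star = M.map star * N.map star := by
  ext i j; simp [Matrix.mul_apply]

theorem map_star_inv {a : ℕ} (M : Matrix (Fin a) (Fin a) ℂ) : M⁻¹.map star = (M.map star)⁻¹ := by
  have h (N : Matrix (Fin a) (Fin a) ℂ) : N.map star = Nᴴᵀ := rfl
  rw [h, h, Matrix.conjTranspose_nonsing_inv, Matrix.transpose_nonsing_inv]

theorem map_star_map_ofReal {a b : ℕ} (M : Matrix (Fin a) (Fin b) ℝ) :
    (M.map Complex.ofReal).map star = M.map Complex.ofReal := by
  ext i j; simp

namespace ParamSystem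

variable {d n m p : ℕ} (S : ParamSystem d n m p)

theorem D_map_star (μ : Par d) (s : ℂ) : (S.D μ s).map star = S.D μ (star s) := by
  have hE : (S.E μ).map star = S.E μ := map_star_map_ofReal _
  have hA : (S.A μ).map star = S.A μ := map_star_map_ofReal _
  rw [D, D, Matrix.map_sub _ star_sub, Matrix.map_smulₛₗ _ star _ fun x ↦ by simp, hE, hA]

theorem H_map_star (μ : Par d) (s : ℂ) : (S.H μ s).map star = S.H μ (star s) := by
  rw [H, H, map_star_mul, map_star_mul, map_star_inv, D_map_star, C, B, map_star_map_ofReal,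
    map_star_map_ofReal]

theorem sigma_neg (μ : Par d) (ω : ℝ) : S.sigma μ (-ω) = S.sigma μ ω := by
  rw [sigma, sigma, ← sigMax_map_star (S.H μ (Complex.I * ω)), H_map_star]
  simp

variable {S} {μ : Par d} {ω : ℝ}

theorem continuousAt_sigma (h : (S.D μ (Complex.I * ω)).det ≠ 0) : ContinuousAt (S.sigma μ) ω :=
  (continuous_singVal 0).continuousAt.comp <|
    (continuousAt_H h).comp (f := fun ω : ℝ ↦ Complex.I * ω) (by fun_prop)

theorem sigmaExt_coe (h : (S.D μ (Complex.I * ω)).det ≠ 0) :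
    S.sigmaExt μ (ω : OnePoint ℝ) = S.sigma μ ω := by
  have hpre : ((↑) : ℝ → OnePoint ℝ) ⁻¹' {(ω : OnePoint ℝ)}ᶜ = {ω}ᶜ := by
    ext x; simp
  rw [sigmaExt, OnePoint.nhdsWithin_coe, comap_map OnePoint.coe_injective, hpre]
  exact ((continuousAt_sigma h).tendsto.mono_left nhdsWithin_le_nhds).limUnder_eq

theorem sigma_eq_zero (h : (S.D μ (Complex.I * ω)).det = 0) : S.sigma μ ω = 0 := by
  rw [sigma, H_eq_zero h, sigMax_eq_norm, norm_zero]

variable {μs : Par d} {ωs : ℝ}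

theorem sigma_le_of_sigmaExt_le (hmax : ∀ x : OnePoint ℝ, S.sigmaExt μs x ≤ S.sigma μs ωs)
    (ω : ℝ) : S.sigma μs ω ≤ S.sigma μs ωs := by
  by_cases h : (S.D μs (Complex.I * ω)).det = 0
  · rw [sigma_eq_zero h]
    exact singVal_nonneg _ 0
  · rw [← sigmaExt_coe h]
    exact hmax ω

/-- Away from the intervals of radius `η` around `±ωs`, the function `σ(μ, ·)` stays below
`σ(μ, ωs)`. -/
def SigmaPeaksNear (S : ParamSystem d n m p) (μ : Par d) (ωs η : ℝ) : Prop :=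
  ∀ ω : ℝ, ω ∉ ball ωs η → ω ∉ ball (-ωs) η → S.sigma μ ω < S.sigma μ ωs

theorem continuousAt_sigma_left (hμ : μ ∈ S.Ω) (hD : (S.D μ (Complex.I * ω)).det ≠ 0) :
    ContinuousAt (fun μ ↦ S.sigma μ ω) μ := by
  have hH := (S.contDiffAt_redH (N := 0) (r := n) (z := (((1, 1), μ), ω)) hμ
    (by rwa [redD_one])).continuousAt.comp (f := fun μ ↦ (((1, 1), μ), ω)) (x := μ) (by fun_prop)
  simp only [Function.comp_def, redH_one] at hH
  exact (continuous_singVal 0).continuousAt.comp hH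

theorem eventually_sigmaPeaksNear
    (hcont : ∀ x : OnePoint ℝ,
      ContinuousAt (fun z : Par d × OnePoint ℝ ↦ S.sigmaExt z.1 z.2) (μs, x))
    (hmax : ∀ x : OnePoint ℝ, S.sigmaExt μs x ≤ S.sigma μs ωs)
    (huniq : ∀ x : OnePoint ℝ, S.sigmaExt μs x = S.sigma μs ωs →
      x = (ωs : OnePoint ℝ) ∨ x = ((-ωs : ℝ) : OnePoint ℝ))
    (hpos : 0 < S.sigma μs ωs) (hσ : ContinuousAt (fun μ ↦ S.sigma μ ωs) μs) {η : ℝ} (hη : 0 < η) :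
    ∀ᶠ μ in 𝓝 μs, S.SigmaPeaksNear μ ωs η := by
  let T : Set (OnePoint ℝ) := ((↑) '' (ball ωs η ∪ ball (-ωs) η))ᶜ
  have hT : IsCompact T :=
    (OnePoint.isOpenEmbedding_coe.isOpenMap _
      (isOpen_ball.union isOpen_ball)).isClosed_compl.isCompact
  have hext : ∀ᶠ μ in 𝓝 μs, ∀ x ∈ T, S.sigmaExt μ x < S.sigma μ ωs := by
    refine hT.eventually_forall_of_forall_eventually fun x hx ↦ ?_
    have hlt : S.sigmaExt μs x < S.sigma μs ωs := by
      refine (hmax x).lt_of_ne fun heq ↦ hx ?_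
      rcases huniq x heq with rfl | rfl
      · exact mem_image_of_mem _ (Or.inl (mem_ball_self hη))
      · exact mem_image_of_mem _ (Or.inr (mem_ball_self hη))
    exact (hcont x).eventually_lt
      (hσ.comp (f := Prod.fst) (x := (μs, x)) continuousAt_fst) hlt
  filter_upwards [hext, hσ.eventually_const_lt hpos] with μ hμ hμpos ω hω hω'
  by_cases h : (S.D μ (Complex.I * ω)).det = 0
  · rwa [sigma_eq_zero h]
  · rw [← sigmaExt_coe h]
    refine hμ _ fun hmem ↦ ?_
    rw [OnePoint.coe_injective.mem_set_image] at hmem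
    exact hmem.elim hω hω'

end ParamSystem

end MaximalFrequency

/-! ### Branches of stationary frequencies -/

section BranchRectangles

open scoped Matrix.Norms.L2Operator

namespace ParamSystem

variable {d n m p r : ℕ} {S : ParamSystem d n m p} {μs : Par d} {ωs β ε δ ημ ηω : ℝ}
  {V W : Matrix (Fin n) (Fin r) ℂ}

theorem mem_reducers_of_le_sigMin (hV : Vᴴ * V = 1) (hW : Wᴴ * W = 1)
    (hsep : β ≤ sigMin (S.redD V W μs (Complex.I * ωs))) : (V, W) ∈ S.reducers μs ωs β r :=
  ⟨hV, hW, fun x ↦ (mul_le_mul_of_nonneg_right hsep (norm_nonneg x)).trans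
    (sigMin_mul_norm_le _ x)⟩

theorem mem_gapReducers (hVW : (V, W) ∈ S.reducers μs ωs β r)
    (hgap : 2 * ε ≤ S.redGap r (((V, W), μs), ωs))
    (hcurv : iteratedDeriv 2 (S.redSigma V W μs) ωs ≤ δ) : (V, W) ∈ S.gapReducers μs ωs β ε δ r :=
  ⟨hVW, hgap, S.iteratedDeriv_two_redSigma V W μs ωs ▸ hcurv⟩

/-- The rectangle `closedBall μs ημ × closedBall ωs ηω` is small enough to carry the branches of
maximizers of all reduced systems with bases in `gapReducers`, of all orders `r ≤ n`. -/
structure IsBranchRectangle (S : ParamSystem d n m p) (μs : Par d) (ωs β ε δ ημ ηω : ℝ) :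
    Prop where
  concave : ∀ r ≤ n, UniformlyConcaveOn (S.redFun r) (δ / 2)
    ((S.gapReducers μs ωs β ε δ r ×ˢ closedBall μs ημ) ×ˢ closedBall ωs ηω)
  regular : ∀ r ≤ n,
    ∀ z ∈ (S.gapReducers μs ωs β ε δ r ×ˢ closedBall μs ημ) ×ˢ closedBall ωs ηω, S.RedRegular r ε z
  exists_crit : ∀ r ≤ n, ∀ θ ∈ S.gapReducers μs ωs β ε δ r, ∀ μ₀ ∈ closedBall μs ημ,
    ∀ ω₀ ∈ closedBall ωs (ηω / 2), derivSnd (S.redFun r) ((θ, μ₀), ω₀) = 0 →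
      ∀ μ ∈ closedBall μs ημ, ∃ ω ∈ ball ωs ηω, derivSnd (S.redFun r) ((θ, μ), ω) = 0

theorem eventually_isBranchRectangle (hμs : μs ∈ S.Ω) (hδ : δ < 0) (hβ : 0 < β) (hε : 0 < ε) :
    ∀ᶠ ηω in 𝓝[>] (0 : ℝ), ∀ᶠ ημ in 𝓝[>] (0 : ℝ),
      S.IsBranchRectangle μs ωs β ε δ ημ ηω := by
  have hK (r : ℕ) : IsCompact (S.gapReducers μs ωs β ε δ r) := isCompact_gapReducers hμs hβ hε
  have hreg (r : ℕ) (θ) (hθ : θ ∈ S.gapReducers μs ωs β ε δ r) : S.RedRegular r ε ((θ, μs), ωs) :=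
    redRegular_of_mem_reducers hμs hβ hε hθ.1 hθ.2.1
  have hconcave (r : ℕ) := eventually_uniformlyConcaveOn (hK r)
    (fun θ hθ ↦ (hreg r θ hθ).contDiffAt hε.le) (fun θ hθ ↦ hθ.2.2) (by linarith : δ < δ / 2)
  have hregular (r : ℕ) := eventually_forall_mem_rectangle (hK r)
    fun θ hθ ↦ (hreg r θ hθ).eventually
  filter_upwards [(finite_Iic n).eventually_all.2 fun r _ ↦ hconcave r,
    (finite_Iic n).eventually_all.2 fun r _ ↦ hregular r, self_mem_nhdsWithin] with ηω hc hr hηω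
  have hcrit (r : ℕ) (hrn : r ∈ Iic n) := UniformlyConcaveOn.eventually_exists_derivSnd_eq_zero
    (hK r) (by linarith : δ / 2 < 0) hηω (hc r hrn)
  filter_upwards [(finite_Iic n).eventually_all.2 hc, (finite_Iic n).eventually_all.2 hr,
    (finite_Iic n).eventually_all.2 hcrit] with ημ hc hr hcrit
  exact ⟨hc, hr, hcrit⟩

/-- The reduced system has a unique branch `ω^{V,W}` of stationary frequencies through `(μ₀, ω₀)`.
The branch is smooth, consists of strict maximizers within `closedBall ωs ηω`, and along it
`σ^{V,W}_{ωω} ≤ δ/2` and `σ^{V,W} - σ₂^{V,W} ≥ ε`. -/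
def HasRedMaxBranch (S : ParamSystem d n m p) (V W : Matrix (Fin n) (Fin r) ℂ) (μs : Par d)
    (ωs δ ε ημ ηω : ℝ) (μ₀ : Par d) (ω₀ : ℝ) : Prop :=
  ∃ w : Par d → ℝ,
    IsCritBranch (S.redSigma V W) μs ωs ημ ηω μ₀ ω₀ w ∧
    ContDiffOn ℝ 3 w (ball μs ημ) ∧
    (∀ w', IsCritBranch (S.redSigma V W) μs ωs ημ ηω μ₀ ω₀ w' → EqOn w' w (closedBall μs ημ)) ∧
    (∀ μ ∈ closedBall μs ημ,
      iteratedDeriv 2 (S.redSigma V W μ) (w μ) ≤ δ / 2 ∧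
      ε ≤ S.redSigma V W μ (w μ) - S.redSigma2 V W μ (w μ) ∧
      ∀ ω ∈ closedBall ωs ηω, ω ≠ w μ →
        S.redSigma V W μ ω < S.redSigma V W μ (w μ) ∧ ¬ HasDerivAt (S.redSigma V W μ) 0 ω) ∧
    ContDiffOn ℝ 3 (fun μ ↦ S.redSigma V W μ (w μ)) (ball μs ημ)

namespace IsBranchRectangle

theorem exists_branch (h : S.IsBranchRectangle μs ωs β ε δ ημ ηω) (hδ : δ < 0) (hr : r ≤ n)
    (hVW : (V, W) ∈ S.gapReducers μs ωs β ε δ r) {μ₀ : Par d} {ω₀ : ℝ}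
    (hμ₀ : μ₀ ∈ closedBall μs ημ) (hω₀ : ω₀ ∈ closedBall ωs (ηω / 2))
    (h₀ : HasDerivAt (S.redSigma V W μ₀) 0 ω₀) :
    S.HasRedMaxBranch V W μs ωs δ ε ημ ηω μ₀ ω₀ := by
  have hδ' : δ / 2 < 0 := by linarith
  have hconcave : UniformlyConcaveOn (S.redSigma V W).uncurry (δ / 2)
      (closedBall μs ημ ×ˢ closedBall ωs ηω) := by
    have hslice := (h.concave r hr).slice hVW
    exact hslice
  have hω₀' : ω₀ ∈ closedBall ωs ηω := by
    rw [mem_closedBall] at hω₀ ⊢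
    linarith [dist_nonneg (x := ω₀) (y := ωs)]
  have hcrit₀ : derivSnd (S.redSigma V W).uncurry (μ₀, ω₀) = 0 := h₀.deriv
  have hcrit : ∀ μ ∈ closedBall μs ημ,
      ∃ ω ∈ ball ωs ηω, derivSnd (S.redSigma V W).uncurry (μ, ω) = 0 :=
    h.exists_crit r hr (V, W) hVW μ₀ hμ₀ ω₀ hω₀ hcrit₀
  have hgap : ∀ μ ∈ closedBall μs ημ, ∀ ω ∈ closedBall ωs ηω,
      ε ≤ S.redSigma V W μ ω - S.redSigma2 V W μ ω := fun μ hμ ω hω ↦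
    (h.regular r hr (((V, W), μ), ω) ⟨⟨hVW, hμ⟩, hω⟩).2.2.le
  obtain ⟨w, hw, hw3⟩ := hconcave.exists_isCritBranch hδ' hcrit hμ₀ hω₀' hcrit₀
  refine ⟨w, hw, hw3.mono ball_subset_closedBall, fun w' hw' ↦ hw.eqOn hconcave hδ' hw',
    fun μ hμ ↦ ⟨hw.iteratedDeriv_two_le hconcave hμ, hgap μ hμ _ (hw.maps hμ), fun ω hω hne ↦ ?_⟩,
    (hw.contDiffOn_value hconcave hw3).mono ball_subset_closedBall⟩
  exact ⟨hw.lt_of_ne hconcave hδ' hμ hω hne,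
    fun hd ↦ hne (hw.eq_of_hasDerivAt_zero hconcave hδ' hμ hω hd)⟩

theorem exists_partialsBoundedBy (h : S.IsBranchRectangle μs ωs β ε δ ημ ηω) (hμs : μs ∈ S.Ω)
    (hδ : δ < 0) (hβ : 0 < β) (hε : 0 < ε) {η' : ℝ} (hη' : η' < ημ) :
    ∃ γ > 0, ∀ r ≤ n, ∀ V W, (V, W) ∈ S.gapReducers μs ωs β ε δ r → ∀ μ₀ ω₀ w,
      IsCritBranch (S.redSigma V W) μs ωs ημ ηω μ₀ ω₀ w →
        ∀ μ ∈ closedBall μs η', PartialsBoundedBy 3 γ (fun ν ↦ S.redSigma V W ν (w ν)) μ := by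
  have hbound (r : ℕ) (hr : r ≤ n) :=
    have : CompleteSpace (BasisPair n r) := FiniteDimensional.complete ℂ _
    (h.concave r hr).exists_partialsBoundedBy_critValue (isCompact_gapReducers hμs hβ hε)
      (by linarith) hη'
  choose! γ hγ hbound using hbound
  have hle (r : ℕ) (hr : r ≤ n) : γ r ≤ ∑ r ∈ Finset.Iic n, γ r :=
    Finset.single_le_sum (fun r hr ↦ (hγ r (Finset.mem_Iic.1 hr)).le) (Finset.mem_Iic.2 hr)
  exact ⟨∑ r ∈ Finset.Iic n, γ r, (hγ n le_rfl).trans_le (hle n le_rfl),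
    fun r hr V W hVW μ₀ ω₀ w hw μ hμ ↦
      (hbound r hr (V, W) hVW μ₀ ω₀ w hw μ hμ).mono (hle r hr)⟩

end IsBranchRectangle

end ParamSystem

end BranchRectangles

section HermitePairs

open scoped Matrix.Norms.L2Operator

namespace GreedyData

variable {d n m p : ℕ} (R : GreedyData d n) (S : ParamSystem d n m p) (j : ℕ)

theorem expandV_le_stepV : ∀ alg, S.expandV (R.μ j) (R.ω j) ≤ R.stepV S j alg
  | .basic => le_rfl
  | .extended => le_sup_left

theorem expandW_le_stepW : ∀ alg, S.expandW (R.μ j) (R.ω j) ≤ R.stepW S j alg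
  | .basic => le_rfl
  | .extended => le_sup_left

end GreedyData

namespace ParamSystem

variable {d n m p r : ℕ}

/-- `V` and `W` are orthonormal bases of subspaces that contain the ones by which the algorithms
expand at `(μ, iω)`, where `ω` is a maximizer of `σ(μ, ·)`. The reduced system is then a Hermite
interpolant of the full one at `(μ, iω)`. -/
structure IsHermitePair (S : ParamSystem d n m p) (V W : Matrix (Fin n) (Fin r) ℂ) (μ : Par d)
    (ω : ℝ) : Prop where
  orthV : Vᴴ * V = 1
  orthW : Wᴴ * W = 1
  isMaxFreq : S.IsMaxFreq μ ω
  expandV_le : S.expandV μ ω ≤ colSpace V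
  expandW_le : S.expandW μ ω ≤ colSpace W

end ParamSystem

theorem GreedyData.IsRun.isHermitePair {d n m p : ℕ} {R : GreedyData d n}
    {S : ParamSystem d n m p} {K : Set (Par d)} {alg : Variant} {k : ℕ} (hR : R.IsRun S K alg k)
    (hk : 1 ≤ k) : S.IsHermitePair (R.V k) (R.W k) (R.μ k) (R.ω k) := by
  obtain ⟨k, rfl⟩ := Nat.exists_eq_add_of_le' hk
  refine ⟨hR.orthV _ le_rfl, hR.orthW _ le_rfl, hR.argmax k k.lt_succ_self, ?_, ?_⟩
  · rw [hR.colV k k.lt_succ_self]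
    exact (R.expandV_le_stepV S (k + 1) alg).trans le_sup_right
  · rw [hR.colW k k.lt_succ_self]
    exact (R.expandW_le_stepW S (k + 1) alg).trans le_sup_right

namespace ParamSystem

variable {d n m p r : ℕ} {S : ParamSystem d n m p} {μ μs : Par d} {ω ωs β ε δ : ℝ}
  {V W : Matrix (Fin n) (Fin r) ℂ}

theorem redRegular_one_iff : S.RedRegular n ε (((1, 1), μ), ω) ↔
    μ ∈ S.Ω ∧ (S.D μ (Complex.I * ω)).det ≠ 0 ∧ ε < S.sigma μ ω - S.sigma2 μ ω := by
  simp only [RedRegular, redGap, redD_one, redSigma_one, redSigma2_one]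

theorem eventually_lt_sigma_sub_sigma2 (hμs : μs ∈ S.Ω) (hD : (S.D μs (Complex.I * ωs)).det ≠ 0)
    (hgap : ε < S.sigma μs ωs - S.sigma2 μs ωs) :
    ∀ᶠ v : Par d × ℝ in 𝓝 (μs, ωs), ε < S.sigma v.1 v.2 - S.sigma2 v.1 v.2 := by
  have hpair : Tendsto (fun v : Par d × ℝ ↦ (((1, 1), v.1), v.2)) (𝓝 (μs, ωs))
      (𝓝 (((1, 1), μs), ωs) : Filter ((BasisPair n n × Par d) × ℝ)) :=
    Continuous.tendsto (by fun_prop) (μs, ωs)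
  filter_upwards [hpair.eventually (redRegular_one_iff.2 ⟨hμs, hD, hgap⟩).eventually] with v hv
  exact (redRegular_one_iff.1 hv).2.2

theorem RedRegular.differentiableAt (h : S.RedRegular r ε (((V, W), μ), ω)) (hε : 0 ≤ ε) :
    DifferentiableAt ℝ (S.redSigma V W μ) ω :=
  (hasDerivAt_derivSnd ((h.contDiffAt (N := 1) hε).differentiableAt one_ne_zero)).differentiableAt

namespace IsHermitePair

theorem redGap_eq (h : S.IsHermitePair V W μ ω) (hDr : (S.redD V W μ (Complex.I * ω)).det ≠ 0) :
    S.redGap r (((V, W), μ), ω) = S.sigma μ ω - S.sigma2 μ ω := by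
  have hH := redH_eq_H h.expandV_le h.expandW_le h.isMaxFreq.2.1.ne_zero hDr
  simp only [redGap, redSigma, redSigma2, sigma, sigma2, hH]

theorem hasDerivAt_redSigma (h : S.IsHermitePair V W μ ω)
    (hgap : 0 < S.sigma μ ω - S.sigma2 μ ω) (hDr : (S.redD V W μ (Complex.I * ω)).det ≠ 0) :
    HasDerivAt (S.redSigma V W μ) 0 ω := by
  obtain ⟨hμ, hD, hmax⟩ := h.isMaxFreq
  have hσ : DifferentiableAt ℝ (S.sigma μ) ω := by
    rw [← redSigma_one]
    exact (redRegular_one_iff.2 ⟨hμ, hD.ne_zero, hgap⟩).differentiableAt le_rfl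
  have hσ₀ : HasDerivAt (S.sigma μ) 0 ω := by
    rw [← IsLocalMax.deriv_eq_zero (Eventually.of_forall hmax)]
    exact hσ.hasDerivAt
  have hred : S.RedRegular r 0 (((V, W), μ), ω) := ⟨hμ, hDr, hgap.trans_eq (h.redGap_eq hDr).symm⟩
  have hpos : S.sigma μ ω ≠ 0 :=
    ((singVal_nonneg _ 1).trans_lt (sub_pos.1 hgap)).ne'
  exact hasDerivAt_redSigma_zero h.expandV_le h.expandW_le hD.ne_zero hDr hpos hσ₀
    (hred.differentiableAt le_rfl)

end IsHermitePair

theorem one_mem_gapReducers (hcurv : iteratedDeriv 2 (S.sigma μs) ωs ≤ δ)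
    (hsep : β ≤ sigMin (S.D μs (Complex.I * ωs)))
    (hgap : 2 * ε ≤ S.sigma μs ωs - S.sigma2 μs ωs) : (1, 1) ∈ S.gapReducers μs ωs β ε δ n := by
  refine mem_gapReducers (mem_reducers_of_le_sigMin ?_ ?_ ?_) ?_ ?_
  · simp
  · simp
  · rwa [redD_one]
  · rwa [redGap, redSigma_one, redSigma2_one]
  · rwa [redSigma_one]

theorem eventually_mem_gapReducers_and_hasDerivAt (hμs : μs ∈ S.Ω) (hβ : 0 < β) (hε : 0 < ε)
    (hD : (S.D μs (Complex.I * ωs)).det ≠ 0)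
    (hgap : 3 * ε < S.sigma μs ωs - S.sigma2 μs ωs) :
    ∀ᶠ v : Par d × ℝ in 𝓝 (μs, ωs), ∀ r ≤ n, ∀ V W : Matrix (Fin n) (Fin r) ℂ,
      S.IsHermitePair V W v.1 v.2 → iteratedDeriv 2 (S.redSigma V W μs) ωs ≤ δ →
        β ≤ sigMin (S.redD V W μs (Complex.I * ωs)) →
          (V, W) ∈ S.gapReducers μs ωs β ε δ r ∧ HasDerivAt (S.redSigma V W v.1) 0 v.2 := by
  have hdet := (finite_Iic n).eventually_all.2 fun r _ ↦
    S.eventually_det_redD_ne_zero_of_mem_reducers (ωs := ωs) (r := r) hμs hβ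
  have hredGap := (finite_Iic n).eventually_all.2 fun r _ ↦
    S.eventually_redGap_lt_add (ωs := ωs) (r := r) hμs hβ hε
  filter_upwards [eventually_lt_sigma_sub_sigma2 hμs hD hgap, hdet, hredGap]
    with v hgap hdet hredGap r hr V W h hcurv hsep
  have hVW : (V, W) ∈ S.reducers μs ωs β r := mem_reducers_of_le_sigMin h.orthV h.orthW hsep
  have hDr : (S.redD V W v.1 (Complex.I * v.2)).det ≠ 0 := hdet r hr (V, W) hVW
  have hlt : S.redGap r (((V, W), v.1), v.2) < S.redGap r (((V, W), μs), ωs) + ε :=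
    hredGap r hr (V, W) hVW
  rw [h.redGap_eq hDr] at hlt
  have hgap_s : 2 * ε ≤ S.redGap r (((V, W), μs), ωs) := by linarith
  exact ⟨mem_gapReducers hVW hgap_s hcurv, h.hasDerivAt_redSigma (by linarith) hDr⟩

theorem SigmaPeaksNear.mem_ball {η : ℝ} (h : S.SigmaPeaksNear μ ωs η) (hω : S.IsMaxFreq μ ω)
    (hsign : 0 ≤ ωs * ω) : ω ∈ ball ωs η := by
  by_contra hfar
  have hneg : ω ∈ ball (-ωs) η := by
    by_contra hneg
    exact (h ω hfar hneg).not_ge (hω.2.2 ωs)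
  refine hfar ?_
  rw [Metric.mem_ball, Real.dist_eq] at hneg ⊢
  exact (sq_le_sq.1 (by nlinarith)).trans_lt hneg

theorem eventually_forall_isMaxFreq {q : Par d × ℝ → Prop}
    (hpeak : ∀ η > 0, ∀ᶠ μ in 𝓝 μs, S.SigmaPeaksNear μ ωs η) (hq : ∀ᶠ v in 𝓝 (μs, ωs), q v) :
    ∀ᶠ μ in 𝓝 μs, ∀ ω, S.IsMaxFreq μ ω → 0 ≤ ωs * ω → q (μ, ω) := by
  obtain ⟨η, hη, hq⟩ := Metric.eventually_nhds_iff.1 hq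
  filter_upwards [hpeak η hη, ball_mem_nhds μs hη] with μ hpeak hμ ω hω hsign
  exact hq (max_lt hμ (hpeak.mem_ball hω hsign))

theorem eventually_isHermitePair_imp {η : ℝ} (hη : 0 < η)
    (hpeak : ∀ η > 0, ∀ᶠ μ in 𝓝 μs, S.SigmaPeaksNear μ ωs η) (hμs : μs ∈ S.Ω) (hβ : 0 < β)
    (hε : 0 < ε) (hD : (S.D μs (Complex.I * ωs)).det ≠ 0)
    (hgap : 3 * ε < S.sigma μs ωs - S.sigma2 μs ωs) :
    ∀ᶠ μ in 𝓝 μs, ∀ r, ∀ V W : Matrix (Fin n) (Fin r) ℂ, ∀ ω, S.IsHermitePair V W μ ω →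
      0 ≤ ωs * ω → iteratedDeriv 2 (S.redSigma V W μs) ωs ≤ δ →
        β ≤ sigMin (S.redD V W μs (Complex.I * ωs)) →
          r ≤ n ∧ (V, W) ∈ S.gapReducers μs ωs β ε δ r ∧ ω ∈ closedBall ωs η ∧
            HasDerivAt (S.redSigma V W μ) 0 ω := by
  have hball : ∀ᶠ v : Par d × ℝ in 𝓝 (μs, ωs), v.2 ∈ closedBall ωs η :=
    continuousAt_snd.eventually (closedBall_mem_nhds ωs hη)
  filter_upwards [eventually_forall_isMaxFreq hpeak <|
    hball.and (eventually_mem_gapReducers_and_hasDerivAt hμs hβ hε hD hgap)]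
    with μ hμ r V W ω h hsign hcurv hsep
  obtain ⟨hω, hmem⟩ := hμ ω h.isMaxFreq hsign
  have hr : r ≤ n := le_of_conjTranspose_mul_self_eq_one h.orthV
  obtain ⟨hVW, h₀⟩ := hmem r hr V W h hcurv hsep
  exact ⟨hr, hVW, hω, h₀⟩

end ParamSystem

end HermitePairs

section FullBranch

open scoped Matrix.Norms.L2Operator

namespace ParamSystem

variable {d n m p : ℕ} {S : ParamSystem d n m p} {μ μs : Par d} {ω ωs β ε δ ημ ηω : ℝ}

theorem SigmaPeaksNear.sigma_lt {η v : ℝ} (h : S.SigmaPeaksNear μ ωs η) (hη : 0 ≤ η)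
    (hv : ∀ ω ∈ closedBall ωs η, ω ≠ v → S.sigma μ ω < S.sigma μ v) (hne : ω ≠ v)
    (hne_neg : ω ≠ -v) : S.sigma μ ω < S.sigma μ v := by
  by_cases hpos : ω ∈ ball ωs η
  · exact hv ω (ball_subset_closedBall hpos) hne
  by_cases hneg : ω ∈ ball (-ωs) η
  · rw [← sigma_neg]
    refine hv (-ω) (ball_subset_closedBall ?_) fun heq ↦ hne_neg (neg_eq_iff_eq_neg.1 heq)
    rwa [Metric.mem_ball, ← dist_neg_neg, neg_neg]
  refine (h ω hpos hneg).trans_le ?_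
  rcases eq_or_ne ωs v with rfl | hωs
  · rfl
  · exact (hv ωs (mem_closedBall_self hη) hωs).le

/-- The full system has a unique branch of stationary frequencies through `(μs, ωs)`. The branch is
smooth, consists of the global maximizers (unique up to sign) of `σ(μ, ·)`, at which the `H∞`-norm
is attained, and along it `σ_{ωω} ≤ δ/2` and `σ - σ₂ ≥ ε`. -/
def HasMaxBranch (S : ParamSystem d n m p) (μs : Par d) (ωs δ ε ημ ηω : ℝ) : Prop :=
  ∃ w : Par d → ℝ,
    IsCritBranch S.sigma μs ωs ημ ηω μs ωs w ∧ ContDiffOn ℝ 3 w (ball μs ημ) ∧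
    (∀ w', IsCritBranch S.sigma μs ωs ημ ηω μs ωs w' → EqOn w' w (closedBall μs ημ)) ∧
    ∀ μ ∈ closedBall μs ημ,
      iteratedDeriv 2 (S.sigma μ) (w μ) ≤ δ / 2 ∧
      ε ≤ S.sigma μ (w μ) - S.sigma2 μ (w μ) ∧
      (∀ ω, S.sigma μ ω ≤ S.sigma μ (w μ)) ∧
      (∀ ω, S.sigma μ ω = S.sigma μ (w μ) → ω = w μ ∨ ω = -w μ) ∧
      S.hinfNorm μ = S.sigma μ (w μ)

namespace IsBranchRectangle

theorem redRegular_one (h : S.IsBranchRectangle μs ωs β ε δ ημ ηω)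
    (hone : (1, 1) ∈ S.gapReducers μs ωs β ε δ n) (hμ : μ ∈ closedBall μs ημ)
    (hω : ω ∈ closedBall ωs ηω) : S.RedRegular n ε (((1, 1), μ), ω) :=
  h.regular n le_rfl (((1, 1), μ), ω) ⟨⟨hone, hμ⟩, hω⟩

theorem hasMaxBranch (h : S.IsBranchRectangle μs ωs β ε δ ημ ηω) (hδ : δ < 0) (hε : 0 < ε)
    (hημ : 0 < ημ) (hηω : 0 < ηω) (hone : (1, 1) ∈ S.gapReducers μs ωs β ε δ n)
    (hmax : ∀ ω, S.sigma μs ω ≤ S.sigma μs ωs) (hinf : ∀ μ ∈ closedBall μs ημ, S.InHinf μ)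
    (hpeak : ∀ μ ∈ closedBall μs ημ, S.SigmaPeaksNear μ ωs ηω) :
    S.HasMaxBranch μs ωs δ ε ημ ηω ∧ ContDiffOn ℝ 3 S.hinfNorm (ball μs ημ) := by
  have hμs : μs ∈ closedBall μs ημ := mem_closedBall_self hημ.le
  have h₀ : HasDerivAt (S.redSigma (1 : Matrix (Fin n) (Fin n) ℂ) 1 μs) 0 ωs := by
    have hd : DifferentiableAt ℝ (S.redSigma (1 : Matrix (Fin n) (Fin n) ℂ) 1 μs) ωs :=
      (h.redRegular_one hone hμs (mem_closedBall_self hηω.le)).differentiableAt hε.le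
    rw [redSigma_one] at hd ⊢
    rw [← IsLocalMax.deriv_eq_zero (Eventually.of_forall hmax)]
    exact hd.hasDerivAt
  obtain ⟨w, hw, hw3, hunique, hprop, hvalue⟩ :=
    h.exists_branch hδ le_rfl hone hμs (mem_closedBall_self (by linarith)) h₀
  simp only [redSigma_one, redSigma2_one] at hw hunique hprop hvalue
  have hlt : ∀ μ ∈ closedBall μs ημ, ∀ ω, ω ≠ w μ → ω ≠ -w μ → S.sigma μ ω < S.sigma μ (w μ) :=
    fun μ hμ ω ↦ (hpeak μ hμ).sigma_lt hηω.le fun ω hω hne ↦ ((hprop μ hμ).2.2 ω hω hne).1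
  have hle : ∀ μ ∈ closedBall μs ημ, ∀ ω, S.sigma μ ω ≤ S.sigma μ (w μ) := by
    intro μ hμ ω
    rcases eq_or_ne ω (w μ) with rfl | hne
    · rfl
    rcases eq_or_ne ω (-w μ) with rfl | hne_neg
    · rw [sigma_neg]
    · exact (hlt μ hμ ω hne hne_neg).le
  have hnorm : ∀ μ ∈ closedBall μs ημ, S.hinfNorm μ = S.sigma μ (w μ) := fun μ hμ ↦
    hinfNorm_eq_sigma (hinf μ hμ)
      (redRegular_one_iff.1 (h.redRegular_one hone hμ (hw.maps hμ))).2.1 (hle μ hμ)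
  refine ⟨⟨w, hw, hw3, hunique, fun μ hμ ↦ ⟨(hprop μ hμ).1, (hprop μ hμ).2.1, hle μ hμ,
    fun ω hω ↦ ?_, hnorm μ hμ⟩⟩, hvalue.congr fun μ hμ ↦ hnorm μ (ball_subset_closedBall hμ)⟩
  by_contra! hne
  exact (hlt μ hμ ω hne.1 hne.2).ne hω

theorem exists_bound (h : S.IsBranchRectangle μs ωs β ε δ ημ ηω) (hμs : μs ∈ S.Ω) (hδ : δ < 0)
    (hβ : 0 < β) (hε : 0 < ε) (hone : (1, 1) ∈ S.gapReducers μs ωs β ε δ n)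
    (hbranch : S.HasMaxBranch μs ωs δ ε ημ ηω) {η' : ℝ} (hη' : η' < ημ) :
    ∃ γ > 0, (∀ μ ∈ closedBall μs η', PartialsBoundedBy 3 γ S.hinfNorm μ) ∧
      ∀ r ≤ n, ∀ V W, (V, W) ∈ S.gapReducers μs ωs β ε δ r → ∀ μ₀ ω₀ w,
        IsCritBranch (S.redSigma V W) μs ωs ημ ηω μ₀ ω₀ w →
          ∀ μ ∈ closedBall μs η', PartialsBoundedBy 3 γ (fun ν ↦ S.redSigma V W ν (w ν)) μ := by
  obtain ⟨w, hw, -, -, hprop⟩ := hbranch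
  obtain ⟨γ, hγ, hbound⟩ := h.exists_partialsBoundedBy hμs hδ hβ hε hη'
  refine ⟨γ, hγ, fun μ hμ ↦ ?_, hbound⟩
  rw [← redSigma_one] at hw
  refine (hbound n le_rfl 1 1 hone μs ωs w hw μ hμ).congr ?_
  filter_upwards [closedBall_mem_nhds_of_mem ((mem_closedBall.1 hμ).trans_lt hη')] with ν hν
  rw [redSigma_one]
  exact (hprop ν hν).2.2.2.2

end IsBranchRectangle

end ParamSystem

end FullBranch

open scoped Matrix.Norms.L2Operator in
theorem lemma3p5_general {d n m p : ℕ} (S : ParamSystem d n m p) {μs : Par d} (hμs : μs ∈ S.Ω)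
    (hnear : ∀ᶠ μ in 𝓝 μs, S.InHinf μ)
    (hcont : ∀ x : OnePoint ℝ,
      ContinuousAt (fun z : Par d × OnePoint ℝ ↦ S.sigmaExt z.1 z.2) (μs, x))
    {ωs : ℝ} (hmax : ∀ x : OnePoint ℝ, S.sigmaExt μs x ≤ S.sigma μs ωs)
    (huniq : ∀ x : OnePoint ℝ, S.sigmaExt μs x = S.sigma μs ωs →
      x = (ωs : OnePoint ℝ) ∨ x = ((-ωs : ℝ) : OnePoint ℝ))
    (hsimple : S.sigma2 μs ωs < S.sigma μs ωs)
    {ι : Type*} {r : ι → ℕ} {V W : ∀ i, Matrix (Fin n) (Fin (r i)) ℂ} {μ₁ μ : ι → Par d}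
    {ω : ι → ℝ} (hpair : ∀ i, S.IsHermitePair (V i) (W i) (μ i) (ω i))
    (hsign : ∀ i, 0 ≤ ωs * ω i) (hconv : Tendsto μ (comap μ₁ (𝓝 μs)) (𝓝 μs))
    {δ β : ℝ} (hδ : δ < 0) (hβ : 0 < β) (hcurv : iteratedDeriv 2 (S.sigma μs) ωs ≤ δ)
    (hsep : β ≤ sigMin (S.D μs (Complex.I * ωs))) :
    ∃ ρ > 0, ∃ ημ > 0, ∃ ηω > 0, ∃ ε > 0,
      S.HasMaxBranch μs ωs δ ε ημ ηω ∧
      ContDiffOn ℝ 3 S.hinfNorm (ball μs ημ) ∧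
      (∀ i, ‖μ₁ i - μs‖ < ρ → iteratedDeriv 2 (S.redSigma (V i) (W i) μs) ωs ≤ δ →
        β ≤ sigMin (S.redD (V i) (W i) μs (Complex.I * ωs)) →
          S.HasRedMaxBranch (V i) (W i) μs ωs δ ε ημ ηω (μ i) (ω i)) ∧
      ∀ η' ∈ Ioo 0 ημ, ∃ γ > 0,
        (∀ μ ∈ closedBall μs η',
          (∀ q r, |partialD q (partialD r S.hinfNorm) μ| ≤ γ) ∧
          (∀ q r l, |partialD q (partialD r (partialD l S.hinfNorm)) μ| ≤ γ)) ∧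
        (∀ i, ‖μ₁ i - μs‖ < ρ → iteratedDeriv 2 (S.redSigma (V i) (W i) μs) ωs ≤ δ →
          β ≤ sigMin (S.redD (V i) (W i) μs (Complex.I * ωs)) →
          ∀ w : Par d → ℝ,
            IsCritBranch (S.redSigma (V i) (W i)) μs ωs ημ ηω (μ i) (ω i) w →
            ∀ μ ∈ closedBall μs η',
              (∀ q r, |partialD q (partialD r
                (fun ν ↦ S.redSigma (V i) (W i) ν (w ν))) μ| ≤ γ) ∧
              (∀ q r l, |partialD q (partialD r (partialD l
                (fun ν ↦ S.redSigma (V i) (W i) ν (w ν)))) μ| ≤ γ)) := by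
  have hD : (S.D μs (Complex.I * ωs)).det ≠ 0 :=
    det_ne_zero_of_mul_norm_le (hβ.trans_le hsep) (sigMin_mul_norm_le _)
  obtain ⟨ε, hε, hgap⟩ : ∃ ε > 0, 3 * ε < S.sigma μs ωs - S.sigma2 μs ωs :=
    ⟨(S.sigma μs ωs - S.sigma2 μs ωs) / 4, by linarith, by linarith⟩
  have hone : (1, 1) ∈ S.gapReducers μs ωs β ε δ n :=
    ParamSystem.one_mem_gapReducers hcurv hsep (by linarith)
  have hpeak (η : ℝ) (hη : η > 0) : ∀ᶠ μ in 𝓝 μs, S.SigmaPeaksNear μ ωs η :=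
    ParamSystem.eventually_sigmaPeaksNear hcont hmax huniq
      ((singVal_nonneg _ 1).trans_lt hsimple) (ParamSystem.continuousAt_sigma_left hμs hD) hη
  obtain ⟨ηω, hrect, hηω : 0 < ηω⟩ := ((ParamSystem.eventually_isBranchRectangle hμs hδ hβ hε).and
    self_mem_nhdsWithin).exists
  obtain ⟨ημ, ⟨hrect, hball⟩, hημ : 0 < ημ⟩ := ((hrect.and <|
    eventually_forall_mem_closedBall (hnear.and (hpeak ηω hηω))).and self_mem_nhdsWithin).exists
  have hmem : ∀ᶠ μ in 𝓝 μs, μ ∈ closedBall μs ημ := closedBall_mem_nhds μs hημ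
  obtain ⟨ρ, hρ, hrun⟩ := Metric.eventually_nhds_iff.1 <| eventually_comap.1 <| hconv.eventually <|
    hmem.and <| ParamSystem.eventually_isHermitePair_imp (δ := δ)
      (half_pos hηω) hpeak hμs hβ hε hD hgap
  have hadm (i) (hi : ‖μ₁ i - μs‖ < ρ) := hrun (by rwa [dist_eq_norm]) i rfl
  obtain ⟨hbranch, hsmooth⟩ := hrect.hasMaxBranch hδ hε hημ hηω hone
    (ParamSystem.sigma_le_of_sigmaExt_le hmax) (fun μ hμ ↦ (hball μ hμ).1)
    fun μ hμ ↦ (hball μ hμ).2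
  refine ⟨ρ, hρ, ημ, hημ, ηω, hηω, ε, hε, hbranch, hsmooth, fun i hi hc hs ↦ ?_, fun η' hη' ↦ ?_⟩
  · obtain ⟨hr, hVW, hω, h₀⟩ := (hadm i hi).2 (r i) (V i) (W i) (ω i) (hpair i) (hsign i) hc hs
    exact hrect.exists_branch hδ hr hVW (hadm i hi).1 hω h₀
  · obtain ⟨γ, hγ, hfull, hred⟩ := hrect.exists_bound hμs hδ hβ hε hone hbranch hη'.2
    refine ⟨γ, hγ, fun μ hμ ↦ (hfull μ hμ).abs_partialD_le, fun i hi hc hs w hw μ hμ ↦ ?_⟩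
    obtain ⟨hr, hVW, -⟩ := (hadm i hi).2 (r i) (V i) (W i) (ω i) (hpair i) (hsign i) hc hs
    exact (hred (r i) hr (V i) (W i) hVW _ _ w hw μ hμ).abs_partialD_le

theorem lemma3p5 {d n m p : ℕ} (S : ParamSystem d n m p)
    -- the feasible set, and the minimizer `μs`
    (K : Set (Par d)) (hK : IsCompact K) (hKΩ : K ⊆ S.Ω)
    (hHinf : ∀ μ ∈ K, S.InHinf μ)
    (μs : Par d) (hμs : μs ∈ K) (hmin : IsLocalMinOn S.hinfNorm K μs)
    (hnear : ∀ᶠ μ in 𝓝 μs, S.InHinf μ)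
    -- the extension of `σ` to frequencies in `ℝ ∪ {∞}` is continuous at the points of
    -- `{μs} × (ℝ ∪ {∞})`
    (hcont : ∀ x : OnePoint ℝ,
      ContinuousAt (fun z : Par d × OnePoint ℝ => S.sigmaExt z.1 z.2) (μs, x))
    -- the maximum of `σ(μs, ·)` is attained exactly at `±ωs`; it is a simple singular value
    (ωs : ℝ) (hmax : ∀ x : OnePoint ℝ, S.sigmaExt μs x ≤ S.sigma μs ωs)
    (huniq : ∀ x : OnePoint ℝ, S.sigmaExt μs x = S.sigma μs ωs →
      x = (ωs : OnePoint ℝ) ∨ x = ((-ωs : ℝ) : OnePoint ℝ))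
    (hpos : 0 < S.sigma μs ωs) (hsimple : S.sigma2 μs ωs < S.sigma μs ωs)
    -- a family of runs of one of the algorithms, with `μ^(k) → μs` as `μ^(1) → μs`
    (alg : Variant) (k : ℕ) (hk : 1 ≤ k) {ι : Type*} (R : ι → GreedyData d n)
    (hR : ∀ i, (R i).IsRun S K alg k)
    (hsign : ∀ i, 0 ≤ ωs * (R i).ω k)
    (hconv : Tendsto (fun i => (R i).μ k) (comap (fun i => (R i).μ 1) (𝓝 μs)) (𝓝 μs))
    (δ β : ℝ) (hδ : δ < 0) (hβ : 0 < β)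
    (hcurv : iteratedDeriv 2 (S.sigma μs) ωs ≤ δ)
    (hsep : β ≤ sigMin (S.D μs (Complex.I * ωs))) :
    ∃ ρ > 0, ∃ ημ > 0, ∃ ηω > 0, ∃ ε > 0,
      -- the maximizer of `σ(μ, ·)`, and the smoothness of `‖H[·]‖`
      (∃ w : Par d → ℝ,
        IsCritBranch S.sigma μs ωs ημ ηω μs ωs w ∧ ContDiffOn ℝ 3 w (ball μs ημ) ∧
        (∀ w', IsCritBranch S.sigma μs ωs ημ ηω μs ωs w' → EqOn w' w (closedBall μs ημ)) ∧
        ∀ μ ∈ closedBall μs ημ,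
          iteratedDeriv 2 (S.sigma μ) (w μ) ≤ δ / 2 ∧
          ε ≤ S.sigma μ (w μ) - S.sigma2 μ (w μ) ∧
          (∀ ω, S.sigma μ ω ≤ S.sigma μ (w μ)) ∧
          (∀ ω, S.sigma μ ω = S.sigma μ (w μ) → ω = w μ ∨ ω = -w μ) ∧
          S.hinfNorm μ = S.sigma μ (w μ)) ∧
      ContDiffOn ℝ 3 S.hinfNorm (ball μs ημ) ∧
      -- the local maximizer of `σ^{V_k,W_k}(μ, ·)`, for all runs that start close to `μs`
      (∀ i, ‖(R i).μ 1 - μs‖ < ρ →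
        iteratedDeriv 2 (S.redSigma ((R i).V k) ((R i).W k) μs) ωs ≤ δ →
        β ≤ sigMin (S.redD ((R i).V k) ((R i).W k) μs (Complex.I * ωs)) →
        ∃ w : Par d → ℝ,
          IsCritBranch (S.redSigma ((R i).V k) ((R i).W k)) μs ωs ημ ηω ((R i).μ k) ((R i).ω k) w ∧
          ContDiffOn ℝ 3 w (ball μs ημ) ∧
          (∀ w', IsCritBranch (S.redSigma ((R i).V k) ((R i).W k)) μs ωs ημ ηω
            ((R i).μ k) ((R i).ω k) w' → EqOn w' w (closedBall μs ημ)) ∧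
          (∀ μ ∈ closedBall μs ημ,
            iteratedDeriv 2 (S.redSigma ((R i).V k) ((R i).W k) μ) (w μ) ≤ δ / 2 ∧
            ε ≤ S.redSigma ((R i).V k) ((R i).W k) μ (w μ)
              - S.redSigma2 ((R i).V k) ((R i).W k) μ (w μ) ∧
            ∀ ω ∈ closedBall ωs ηω, ω ≠ w μ →
              S.redSigma ((R i).V k) ((R i).W k) μ ω
                < S.redSigma ((R i).V k) ((R i).W k) μ (w μ) ∧
              ¬ HasDerivAt (S.redSigma ((R i).V k) ((R i).W k) μ) 0 ω) ∧
          ContDiffOn ℝ 3 (fun μ => S.redSigma ((R i).V k) ((R i).W k) μ (w μ)) (ball μs ημ)) ∧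
      -- the bounds on the derivatives of order two and three
      ∀ η' ∈ Ioo 0 ημ, ∃ γ > 0,
        (∀ μ ∈ closedBall μs η',
          (∀ q r, |partialD q (partialD r S.hinfNorm) μ| ≤ γ) ∧
          (∀ q r l, |partialD q (partialD r (partialD l S.hinfNorm)) μ| ≤ γ)) ∧
        (∀ i, ‖(R i).μ 1 - μs‖ < ρ →
          iteratedDeriv 2 (S.redSigma ((R i).V k) ((R i).W k) μs) ωs ≤ δ →
          β ≤ sigMin (S.redD ((R i).V k) ((R i).W k) μs (Complex.I * ωs)) →
          ∀ w : Par d → ℝ,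
            IsCritBranch (S.redSigma ((R i).V k) ((R i).W k)) μs ωs ημ ηω
              ((R i).μ k) ((R i).ω k) w →
            ∀ μ ∈ closedBall μs η',
              (∀ q r, |partialD q (partialD r
                (fun ν => S.redSigma ((R i).V k) ((R i).W k) ν (w ν))) μ| ≤ γ) ∧
              (∀ q r l, |partialD q (partialD r (partialD l
                (fun ν => S.redSigma ((R i).V k) ((R i).W k) ν (w ν)))) μ| ≤ γ)) :=
  lemma3p5_general S (hKΩ hμs) hnear hcont hmax huniq hsimple (fun i ↦ (hR i).isHermitePair hk)
    hsign hconv hδ hβ hcurv hsep
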